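/- **Setting.** Let $c,\gamma,k>0$ and $\alpha\in(\tfrac12,1]$ be constants, $(\Omega,\mathcal F,\mathbb P)$ a probability space, $\mathbb S^2\subset\mathbb R^3$ the unit sphere with normalized surface measure $\mu$ ($\mu(\mathbb S^2)=1$), and $Y_{\ell,m}$ ($\ell\in\mathbb N_0$, $m=-\ell,\dots,\ell$) the standard real spherical harmonics, orthonormal in $L_2(\mathbb S^2,\mu)$. A random field on $\mathbb S^2$ is a jointly measurable function $\xi:\Omega\times\mathbb S^2\to\mathbb R$; it is *Gaussian* if all vectors $(\xi(x_1),\dots,\xi(x_n))$ are (possibly degenerate) multivariate Gaussian, *centred* if $\mathbb E[\xi(x)]=0$ for all $x$, and *2-weakly isotropic* if $\mathbb E[\xi(x)^2]<\infty$, $\mathbb E[\xi(x)]=\mathbb E[\xi(\rho x)]$ and $\mathbb E[\xi(x)\xi(y)]=\mathbb E[\xi(\rho x)\xi(\rho y)]$ for all $x,y\in\mathbb S^2$, $\rho\in SO(3)$. Write $\widehat\xi_{\ell,m}=\int_{\mathbb S^2}\xi\,Y_{\ell,m}\,d\mu$. The angular power spectrum of a centred 2-weakly isotropic field $\xi$ is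 $\mathcal C_\ell=\frac1{2\ell+1}\sum_{m=-\ell}^{\ell}\mathbb E[\widehat\xi_{\ell,m}^{\,2}]$. Let $E_{a,b}(z)=\sum_{r\ge0}z^r/\Gamma(ar+b)$, $E_a=E_{a,1}$, $\lambda_\ell=\ell(\ell+1)$, $\omega=\frac{c}{2\gamma k}$, $\varkappa=\frac12(\sqrt{1+4\omega^2}-1)$, $M_\ell=\sqrt{1-\lambda_\ell\omega^{-2}}$ for $\ell\le\varkappa$ and $M_\ell=\mathrm i\sqrt{\lambda_\ell\omega^{-2}-1}$ for $\ell>\varkappa$, $z_\ell^{\pm}=\frac{c^2}{2\gamma}(1\pm M_\ell)$, $z_\varkappa=\frac{c^2}{2\gamma}$. For $t\ge0$ put $$F_{\ell,\alpha}(t)=\tfrac12\big[E_\alpha(-z_\ell^-t^\alpha)+E_\alpha(-z_\ell^+t^\alpha)\big]+\tfrac1{2M_\ell}\big[E_\alpha(-z_\ell^-t^\alpha)-E_\alpha(-z_\ell^+t^\alpha)\big]\quad(\ell\ne\varkappa),$$ $$F_{\varkappa,\alpha}(t)=E_\alpha(-z_\varkappa t^\alpha)\Big(1+\tfrac{c^2}{2\alpha\gamma}t^\alpha\Big)\quad(\text{if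 }\varkappa\in\mathbb N).$$ **Proposition.** Let $\xi$ be a centred, 2-weakly isotropic Gaussian random field on $\mathbb S^2$ whose angular power spectrum satisfies, for some $\widetilde D,\widetilde C>0$ and $\kappa_1>4$, $\mathcal C_0\le\widetilde D$ and $\mathcal C_\ell\le\widetilde C\,\ell^{-\kappa_1}$ for $\ell\ge1$. Let $t\ge0$ and $$U^H(t)=\sum_{\ell=0}^\infty\sum_{m=-\ell}^{\ell}\widehat\xi_{\ell,m}\,F_{\ell,\alpha}(t)\,Y_{\ell,m},$$ evaluated at $(\omega,x)$ as the sum over $\ell$ of the (finite) inner sums over $m$ if it converges absolutely, and as $0$ otherwise. Then the $F_{\ell,\alpha}(t)$ are real, $U^H(t)$ is a random field in $L_2(\Omega\times\mathbb S^2)$ to which the series converges in $L_2(\Omega\times\mathbb S^2)$, and $U^H(t)$ is a centred, 2-weakly isotropic Gaussian random field. Its coefficients $\widehat{U^H}_{\ell,m}(t)=\int_{\mathbb S^2}U^H(t)\,Y_{\ell,m}\,d\mu$ satisfy $\widehat{U^H}_{\ell,m}(t)=F_{\ell,\alpha}(t)\,\widehat\xi_{\ell,m}$ almost surely, are square integrable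 with mean zero, and $$\mathbb E\big[\widehat{U^H}_{\ell,m}(t)\,\widehat{U^H}_{\ell',m'}(t)\big]=|F_{\ell,\alpha}(t)|^2\,\mathcal C_\ell\,\delta_{\ell\ell'}\delta_{mm'}$$ for all $\ell,\ell'\in\mathbb N_0$, $|m|\le\ell$, $|m'|\le\ell'$. All of this holds as well if, for $\ell=\varkappa$, $F_{\varkappa,\alpha}(t)$ is replaced throughout by $E_\alpha(-z_\varkappa t^\alpha)+\frac{c^2}{2\alpha\gamma}t^\alpha E_{\alpha,\alpha}(-z_\varkappa t^\alpha)$, the limit of the expression for $\ell\neq\varkappa$ as $M_\ell\to0$. -/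

import Mathlib

open MeasureTheory ProbabilityTheory Filter Topology

noncomputable section

namespace SphericalField

/-- Euclidean space `ℝ³`. -/
abbrev E3 : Type := EuclideanSpace ℝ (Fin 3)

/-- The unit sphere `𝕊²` of `ℝ³`. -/
abbrev S2 : Type := Metric.sphere (0 : E3) 1

/-- The normalized surface measure on the sphere: total mass one. -/
def sphereMeasure : Measure S2 :=
  ((volume : Measure E3).toSphere Set.univ)⁻¹ • (volume : Measure E3).toSphere

/-- A linear isometry of `ℝ³` acting on the sphere. -/
def rotate (ρ : E3 ≃ₗᵢ[ℝ] E3) (x : S2) : S2 :=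
  ⟨ρ x, by simp⟩

/-- `ρ` belongs to the rotation group `SO(3)`. -/
def IsRotation (ρ : E3 ≃ₗᵢ[ℝ] E3) : Prop :=
  LinearMap.det (ρ.toLinearEquiv : E3 →ₗ[ℝ] E3) = 1

/-! ### Real spherical harmonics -/

/-- The Legendre polynomial of degree `ℓ` (Rodrigues' formula). -/
def legendre (ℓ : ℕ) : Polynomial ℝ :=
  Polynomial.C (1 / (2 ^ ℓ * (ℓ.factorial : ℝ))) *
    (Polynomial.derivative^[ℓ] ((Polynomial.X ^ 2 - 1) ^ ℓ))

/-- Normalizing constant `(-1)^m √((2ℓ+1)(ℓ-m)!/(ℓ+m)!)`, for `0 ≤ m ≤ ℓ`. -/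
def harmonicConst (ℓ m : ℕ) : ℝ :=
  (-1) ^ m * Real.sqrt ((2 * ℓ + 1) * ((ℓ - m).factorial : ℝ) / ((ℓ + m).factorial : ℝ))

/-- The real spherical harmonic `Y_{ℓ,m}`, `-ℓ ≤ m ≤ ℓ`, orthonormal for the normalized surface
measure. At the point with spherical coordinates `(θ, φ)` one has `x₃ = cos θ` and
`(x₁ + i x₂)^j = (sin θ)^j (cos (jφ) + i sin (jφ))`. With `j = |m|` and the associated Legendre
function `P_{ℓ,j}(u) = (1 - u²)^{j/2} P_ℓ^{(j)}(u)`, the three cases below are therefore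
`(-1)^m √2 √((2ℓ+1)(ℓ-j)!/(ℓ+j)!) P_{ℓ,j}(cos θ) sin (jφ)` for `m < 0`,
`√(2ℓ+1) P_ℓ(cos θ)` for `m = 0`, and
`(-1)^m √2 √((2ℓ+1)(ℓ-j)!/(ℓ+j)!) P_{ℓ,j}(cos θ) cos (jφ)` for `m > 0`. -/
def Y (ℓ : ℕ) (m : ℤ) (x : S2) : ℝ :=
  let w : ℂ := ⟨(x : E3) 0, (x : E3) 1⟩
  let p : ℝ := (Polynomial.derivative^[m.natAbs] (legendre ℓ)).eval ((x : E3) 2)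
  if m < 0 then Real.sqrt 2 * harmonicConst ℓ m.natAbs * p * (w ^ m.natAbs).im
  else if m = 0 then Real.sqrt (2 * ℓ + 1) * p
  else Real.sqrt 2 * harmonicConst ℓ m.natAbs * p * (w ^ m.natAbs).re

/-- The indices `m = -ℓ, …, ℓ`. -/
def orders (ℓ : ℕ) : Finset ℤ := Finset.Icc (-(ℓ : ℤ)) (ℓ : ℤ)

/-! ### Random fields on the sphere -/

section Fields

variable {Ω : Type*} [MeasurableSpace Ω]

/-- A real random field on the sphere: a jointly measurable function on `Ω × 𝕊²`. -/
def IsRandomField (ξ : Ω → S2 → ℝ) : Prop :=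
  Measurable (fun p : Ω × S2 => ξ p.1 p.2)

/-- The field is centred: every `ξ(x)` is integrable with mean zero. -/
def IsCentred (P : Measure Ω) (ξ : Ω → S2 → ℝ) : Prop :=
  ∀ x, Integrable (fun ω => ξ ω x) P ∧ ∫ ω, ξ ω x ∂P = 0

/-- 2-weak isotropy: finite second moments, and first and second moments invariant under all
rotations. -/
def IsTwoWeaklyIsotropic (P : Measure Ω) (ξ : Ω → S2 → ℝ) : Prop :=
  (∀ x, MemLp (fun ω => ξ ω x) 2 P) ∧
  ∀ ρ : E3 ≃ₗᵢ[ℝ] E3, IsRotation ρ → ∀ x y : S2,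
    ∫ ω, ξ ω x ∂P = ∫ ω, ξ ω (rotate ρ x) ∂P ∧
    ∫ ω, ξ ω x * ξ ω y ∂P = ∫ ω, ξ ω (rotate ρ x) * ξ ω (rotate ρ y) ∂P

/-- A Gaussian field: all finite families `(ξ(x₁), …, ξ(x_k))` are jointly Gaussian. -/
def IsGaussianField (P : Measure Ω) (ξ : Ω → S2 → ℝ) : Prop :=
  IsGaussianProcess (fun (x : S2) (ω : Ω) => ξ ω x) P

/-- The random Fourier coefficient `∫ ξ(x) Y_{ℓ,m}(x) dμ(x)` of the field `ξ`. -/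
def coeff (ξ : Ω → S2 → ℝ) (ℓ : ℕ) (m : ℤ) (ω : Ω) : ℝ :=
  ∫ x, ξ ω x * Y ℓ m x ∂sphereMeasure

/-- The angular power spectrum `C_ℓ` of a centred 2-weakly isotropic field: the second moment
of the coefficients of degree `ℓ`, averaged over the orders `m = -ℓ, …, ℓ`. (That each
coefficient has this variance and that distinct ones are uncorrelated is not part of the
definition.) -/
def angularPowerSpectrum (P : Measure Ω) (ξ : Ω → S2 → ℝ) (ℓ : ℕ) : ℝ :=
  (∑ m ∈ orders ℓ, ∫ ω, (coeff ξ ℓ m ω) ^ 2 ∂P) / (2 * ℓ + 1)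

end Fields

/-! ### The time factors -/

/-- The two-parameter Mittag-Leffler function `E_{a,b}(z) = ∑_r z^r / Γ(a r + b)`. -/
def mittagLeffler (a b : ℝ) (z : ℂ) : ℂ :=
  ∑' r : ℕ, z ^ r / ((Real.Gamma (a * r + b) : ℝ) : ℂ)

/-- The eigenvalue `λ_ℓ = ℓ(ℓ+1)` of the negative Laplace-Beltrami operator. -/
def eigen (ℓ : ℕ) : ℝ := ℓ * (ℓ + 1)

/-- `ω = c / (2 γ k)`. -/
def omega (c γ k : ℝ) : ℝ := c / (2 * γ * k)

/-- The critical degree `ϰ = (√(1 + 4 ω²) - 1) / 2`, for which `ϰ (ϰ + 1) = ω²`. -/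
def kappa (c γ k : ℝ) : ℝ := (Real.sqrt (1 + 4 * omega c γ k ^ 2) - 1) / 2

/-- `M_ℓ`: equal to `√(1 - λ_ℓ ω⁻²)` for `ℓ ≤ ϰ` and to `i √(λ_ℓ ω⁻² - 1)` for `ℓ > ϰ`. -/
def M (c γ k : ℝ) (ℓ : ℕ) : ℂ :=
  if (ℓ : ℝ) ≤ kappa c γ k then
    ((Real.sqrt (1 - eigen ℓ * (omega c γ k ^ 2)⁻¹) : ℝ) : ℂ)
  else
    Complex.I * ((Real.sqrt (eigen ℓ * (omega c γ k ^ 2)⁻¹ - 1) : ℝ) : ℂ)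

/-- `z_ℓ⁺ = c² (1 + M_ℓ) / (2γ)`. -/
def zPlus (c γ k : ℝ) (ℓ : ℕ) : ℂ := ((c ^ 2 / (2 * γ) : ℝ) : ℂ) * (1 + M c γ k ℓ)

/-- `z_ℓ⁻ = c² (1 - M_ℓ) / (2γ)`. -/
def zMinus (c γ k : ℝ) (ℓ : ℕ) : ℂ := ((c ^ 2 / (2 * γ) : ℝ) : ℂ) * (1 - M c γ k ℓ)

/-- `z_ϰ = c² / (2γ)`. -/
def zCrit (c γ : ℝ) : ℂ := ((c ^ 2 / (2 * γ) : ℝ) : ℂ)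

/-- `F⁽¹⁾_{ℓ,α}(t) = (E_α(-z_ℓ⁻ t^α) + E_α(-z_ℓ⁺ t^α)) / 2`. -/
def F1 (c γ k α : ℝ) (ℓ : ℕ) (t : ℝ) : ℂ :=
  (mittagLeffler α 1 (-zMinus c γ k ℓ * ((t ^ α : ℝ) : ℂ)) +
    mittagLeffler α 1 (-zPlus c γ k ℓ * ((t ^ α : ℝ) : ℂ))) / 2

/-- `F⁽²⁾_{ℓ,α}(t) = (E_α(-z_ℓ⁻ t^α) - E_α(-z_ℓ⁺ t^α)) / (2 M_ℓ)`. -/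
def F2 (c γ k α : ℝ) (ℓ : ℕ) (t : ℝ) : ℂ :=
  (mittagLeffler α 1 (-zMinus c γ k ℓ * ((t ^ α : ℝ) : ℂ)) -
    mittagLeffler α 1 (-zPlus c γ k ℓ * ((t ^ α : ℝ) : ℂ))) / (2 * M c γ k ℓ)

/-- The time factor `F_{ℓ,α}(t)`: `F⁽¹⁾ + F⁽²⁾` for `ℓ ≠ ϰ`, and
`E_α(-z_ϰ t^α) (1 + c² t^α / (2αγ))` for `ℓ = ϰ`. -/
def F (c γ k α : ℝ) (ℓ : ℕ) (t : ℝ) : ℂ :=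
  if (ℓ : ℝ) ≠ kappa c γ k then F1 c γ k α ℓ t + F2 c γ k α ℓ t
  else mittagLeffler α 1 (-zCrit c γ * ((t ^ α : ℝ) : ℂ)) *
    (1 + ((c ^ 2 / (2 * α * γ) * t ^ α : ℝ) : ℂ))

/-- The variant of the time factor whose value for `ℓ = ϰ` is the limit of `F⁽¹⁾ + F⁽²⁾` as
`M_ℓ → 0`, namely `E_α(-z_ϰ t^α) + (c² t^α / (2αγ)) E_{α,α}(-z_ϰ t^α)`. It coincides with `F` for
`ℓ ≠ ϰ`, and for `α = 1`. -/
def FLim (c γ k α : ℝ) (ℓ : ℕ) (t : ℝ) : ℂ :=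
  if (ℓ : ℝ) ≠ kappa c γ k then F1 c γ k α ℓ t + F2 c γ k α ℓ t
  else mittagLeffler α 1 (-zCrit c γ * ((t ^ α : ℝ) : ℂ)) +
    ((c ^ 2 / (2 * α * γ) * t ^ α : ℝ) : ℂ) *
      mittagLeffler α α (-zCrit c γ * ((t ^ α : ℝ) : ℂ))

/-! ### The homogeneous solution -/

section Solution

variable {Ω : Type*} [MeasurableSpace Ω]

/-- The part of degree `ℓ` of the series,
`∑_{m=-ℓ}^{ℓ} ξ̂_{ℓ,m} G_ℓ(t) Y_{ℓ,m}(x)`, for real-valued time factors `G`. -/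
def degreePart (ξ : Ω → S2 → ℝ) (G : ℕ → ℝ → ℂ) (t : ℝ) (ℓ : ℕ) (ω : Ω) (x : S2) : ℝ :=
  ∑ m ∈ orders ℓ, coeff ξ ℓ m ω * (G ℓ t).re * Y ℓ m x

/-- The field `∑_ℓ ∑_m ξ̂_{ℓ,m} G_ℓ(t) Y_{ℓ,m}(x)`. -/
def homField (ξ : Ω → S2 → ℝ) (G : ℕ → ℝ → ℂ) (t : ℝ) (ω : Ω) (x : S2) : ℝ :=
  ∑' ℓ : ℕ, degreePart ξ G t ℓ ω x

/-- Convergence of the series to the field `V` in `L₂(Ω × 𝕊²)`. -/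
def SeriesTendsto (P : Measure Ω) (ξ : Ω → S2 → ℝ) (G : ℕ → ℝ → ℂ) (t : ℝ)
    (V : Ω → S2 → ℝ) : Prop :=
  Tendsto (fun L : ℕ => eLpNorm (fun p : Ω × S2 =>
      (∑ ℓ ∈ Finset.range (L + 1), degreePart ξ G t ℓ p.1 p.2) - V p.1 p.2)
    2 (P.prod sphereMeasure)) atTop (𝓝 0)

end Solution

end SphericalField

end

open MeasureTheory ProbabilityTheory Filter Topology

noncomputable section

namespace SphericalField

/-! Everything reduces to two facts: for fixed $t$ the time factors are bounded in $\ell$, and the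
coefficients of an isotropic field are uncorrelated with a variance that depends on the degree only.

Boundedness. For $\ell>\varkappa$ the number $M_\ell$ is purely imaginary, so $-z_\ell^\pm t^\alpha$
lies in the closed left half-plane, where $|E_\alpha|\le1$ (`norm_mittagLeffler_neg_le_one`). No
integral representation of $E_\alpha$ is needed for this: $E_\alpha(-z)$ is the value at time one of
the fractional relaxation equation, and the implicit Grünwald-Letnikov scheme with step $1/n$ has
explicit binomial coefficients. Each step of the scheme writes $(1+\zeta)g_n$ as a combination of
$1$ and earlier values with nonnegative weights of total mass one. As $|1+\zeta|\ge1$, this gives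
$|g_n|\le1$, and the bound survives $n\to\infty$. The remaining finitely many degrees, among them
$\ell=\varkappa$ for either choice of its factor, need no estimate.

Uncorrelated coefficients. The $L_2(\mathbb S^2)$ inner product and the covariance form
$(f,g)\mapsto\mathbb E[\langle\xi,f\rangle\langle\xi,g\rangle]$ are both symmetric bilinear forms
invariant under rotations. Differentiating along rotations about two axes gives ladder relations
between harmonics of neighbouring orders, and these alone force the form to be diagonal in
$Y_{\ell,m}$ with an eigenvalue independent of $m$ (`IsInvariantForm.Y_Y`), a hands-on Schur lemma.
The eigenvalue is then read off from the trace over $m$. The same ladder relations yield the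
addition theorem (`zonalKernel_eq_legendre`), which makes the covariance of each degree part a
function of $\langle x,y\rangle$.

The series. The part of degree $\ell$ has standard deviation at most
$|G_\ell(t)|\sqrt{(2\ell+1)\mathcal C_\ell}$ at every point, which is summable by the decay of the
spectrum. Hence the series converges absolutely almost everywhere and in $L_2$, both at each fixed
$x$ and on $\Omega\times\mathbb S^2$; isotropy and the coefficients pass to the limit. Gaussianity
holds because every value of the field lies in the closed linear span of the variables $\xi(x)$ in
$L_2(\Omega)$, all of whose elements are centred Gaussian
(`isGaussianProcess_of_mem_gaussianSpace`). -/

/-! ### The Mittag-Leffler function on the left half-plane -/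

/-- The coefficient of `x ^ n` in the binomial series of `(1 - x) ^ (-a)`. -/
def risingCoeff (a : ℝ) (n : ℕ) : ℝ := ∏ j ∈ Finset.range n, (a + j) / (j + 1)

@[simp] lemma risingCoeff_zero (a : ℝ) : risingCoeff a 0 = 1 := by simp [risingCoeff]

lemma risingCoeff_succ (a : ℝ) (n : ℕ) :
    (n + 1) * risingCoeff a (n + 1) = (a + n) * risingCoeff a n := by
  have : (n + 1 : ℝ) ≠ 0 := by positivity
  rw [risingCoeff, Finset.prod_range_succ, ← risingCoeff]
  field_simp

lemma risingCoeff_nonneg {a : ℝ} (ha : 0 ≤ a) (n : ℕ) : 0 ≤ risingCoeff a n :=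
  Finset.prod_nonneg fun j _ => by positivity

/-- Only the factor $j=0$, equal to $-a$, is nonpositive. This sign is what makes the weights of the
Grünwald-Letnikov recursion nonnegative. -/
lemma risingCoeff_neg_succ_nonpos {a : ℝ} (ha : 0 ≤ a) (ha1 : a ≤ 1) (n : ℕ) :
    risingCoeff (-a) (n + 1) ≤ 0 := by
  rw [risingCoeff, Finset.prod_range_succ']
  refine mul_nonpos_of_nonneg_of_nonpos (Finset.prod_nonneg fun j _ => ?_) (by simpa using ha)
  have : (0 : ℝ) ≤ j := by positivity
  exact div_nonneg (by push_cast; linarith) (by positivity)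

lemma risingCoeff_one (n : ℕ) : risingCoeff 1 n = 1 :=
  Finset.prod_eq_one fun j _ => by
    rw [add_comm (1 : ℝ), div_self (by positivity)]

/-- The Vandermonde convolution `(1 - x) ^ (-a) (1 - x) ^ (-b) = (1 - x) ^ (-(a + b))`. -/
lemma sum_antidiagonal_risingCoeff (a b : ℝ) (n : ℕ) :
    ∑ p ∈ Finset.HasAntidiagonal.antidiagonal n, risingCoeff a p.1 * risingCoeff b p.2 =
      risingCoeff (a + b) n := by
  induction n with
  | zero => simp
  | succ n ih =>
    have hn : (n + 1 : ℝ) ≠ 0 := by positivity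
    -- The factor $n+1=p_1+p_2$ plays the role of the Euler operator $x\,d/dx$: it is distributed
    -- over the two factors by the product rule, and each half is lowered by `risingCoeff_succ`.
    refine mul_left_cancel₀ hn ?_
    rw [risingCoeff_succ, ← ih]
    have h1 : ∑ p ∈ Finset.HasAntidiagonal.antidiagonal (n + 1), (p.1 : ℝ) * (risingCoeff a p.1 * risingCoeff b p.2)
        = ∑ p ∈ Finset.HasAntidiagonal.antidiagonal n, (a + p.1) * (risingCoeff a p.1 * risingCoeff b p.2) := by
      rw [Finset.Nat.sum_antidiagonal_succ]
      simp only [Nat.cast_zero, zero_mul, zero_add]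
      refine Finset.sum_congr rfl fun p _ => ?_
      rw [← mul_assoc, Nat.cast_succ, risingCoeff_succ, mul_assoc]
    have h2 : ∑ p ∈ Finset.HasAntidiagonal.antidiagonal (n + 1), (p.2 : ℝ) * (risingCoeff a p.1 * risingCoeff b p.2)
        = ∑ p ∈ Finset.HasAntidiagonal.antidiagonal n, (b + p.2) * (risingCoeff a p.1 * risingCoeff b p.2) := by
      rw [Finset.Nat.sum_antidiagonal_succ']
      simp only [Nat.cast_zero, zero_mul, zero_add]
      refine Finset.sum_congr rfl fun p _ => ?_
      rw [mul_left_comm, Nat.cast_succ, risingCoeff_succ]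
      ring
    have h3 : ∑ p ∈ Finset.HasAntidiagonal.antidiagonal (n + 1), ((n : ℝ) + 1) * (risingCoeff a p.1 * risingCoeff b p.2)
        = ∑ p ∈ Finset.HasAntidiagonal.antidiagonal (n + 1), (p.1 : ℝ) * (risingCoeff a p.1 * risingCoeff b p.2) +
          ∑ p ∈ Finset.HasAntidiagonal.antidiagonal (n + 1), (p.2 : ℝ) * (risingCoeff a p.1 * risingCoeff b p.2) := by
      rw [← Finset.sum_add_distrib]
      refine Finset.sum_congr rfl fun p hp => ?_
      have := Finset.HasAntidiagonal.mem_antidiagonal.1 hp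
      have : (p.1 : ℝ) + p.2 = n + 1 := by exact_mod_cast this
      rw [← this]; ring
    rw [Finset.mul_sum, h3, h1, h2, ← Finset.sum_add_distrib, Finset.mul_sum]
    refine Finset.sum_congr rfl fun p hp => ?_
    have := Finset.HasAntidiagonal.mem_antidiagonal.1 hp
    have : (p.1 : ℝ) + p.2 = n := by exact_mod_cast this
    rw [← this]; ring

/-- Summing coefficients is multiplication of the generating function by $(1-x)^{-1}$. -/
lemma sum_range_risingCoeff (a : ℝ) (n : ℕ) :
    ∑ j ∈ Finset.range (n + 1), risingCoeff a j = risingCoeff (a + 1) n := by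
  rw [← sum_antidiagonal_risingCoeff, Finset.Nat.sum_antidiagonal_eq_sum_range_succ_mk]
  simp [risingCoeff_one]

lemma choose_eq_risingCoeff (a : ℝ) (n : ℕ) :
    Ring.choose (a + n - 1) n = risingCoeff a n := by
  rw [← Ring.multichoose_eq]
  have h := Ring.factorial_nsmul_multichoose_eq_ascPochhammer a n
  rw [Polynomial.ascPochhammer_smeval_eq_eval] at h
  have h2 : (ascPochhammer ℝ n).eval a = n.factorial * risingCoeff a n := by
    clear h
    induction n with
    | zero => simp
    | succ n ih =>
      rw [ascPochhammer_succ_eval, ih, Nat.factorial_succ]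
      push_cast
      linear_combination -(n.factorial : ℝ) * risingCoeff_succ a n
  rw [h2, nsmul_eq_mul] at h
  exact mul_left_cancel₀ (by positivity) h

lemma hasSum_risingCoeff (a : ℝ) {x : ℝ} (hx0 : 0 ≤ x) (hx1 : x < 1) :
    HasSum (fun n => risingCoeff a n * x ^ n) (1 / (1 - x) ^ a) := by
  have h := (Real.one_div_one_sub_rpow_hasFPowerSeriesOnBall_zero a).hasSum (y := x) (by
    simp [abs_of_nonneg hx0, hx1, enorm_eq_nnnorm, ← NNReal.coe_lt_coe])
  simpa [choose_eq_risingCoeff, FormalMultilinearSeries.ofScalars, mul_comm] using h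

/-- The coefficient is a partial sum of those of $(1-x)^{-s}$. At $x=1-y$ one has $x^n\le x^j$ for
$j\le n$, and the full series of nonnegative terms sums to $y^{-s}$. -/
lemma risingCoeff_mul_le {s : ℝ} (hs : 0 ≤ s) (n : ℕ) {y : ℝ} (hy0 : 0 < y) (hy1 : y ≤ 1) :
    risingCoeff (s + 1) n * (1 - y) ^ n ≤ y ^ (-s) := by
  have h := hasSum_risingCoeff s (x := 1 - y) (by linarith) (by linarith)
  rw [sub_sub_cancel, one_div, ← Real.rpow_neg hy0.le] at h
  rw [← sum_range_risingCoeff, Finset.sum_mul]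
  refine le_trans (Finset.sum_le_sum fun j hj => ?_)
    (sum_le_hasSum (Finset.range (n + 1))
      (fun j _ => mul_nonneg (risingCoeff_nonneg hs j) (pow_nonneg (by linarith) j)) h)
  refine mul_le_mul_of_nonneg_left ?_ (risingCoeff_nonneg hs j)
  exact pow_le_pow_of_le_one (by linarith) (by linarith)
    (Nat.lt_succ_iff.1 (Finset.mem_range.1 hj))

/-- The generating coefficients of the Grünwald-Letnikov scheme for the fractional relaxation
equation: `∑ₙ gruenwald α ζ n xⁿ = (1 - x) ^ (α - 1) / ((1 - x) ^ α + ζ)`. -/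
def gruenwald (α : ℝ) (ζ : ℂ) (n : ℕ) : ℂ :=
  ∑' r : ℕ, (-ζ) ^ r * (risingCoeff (α * r + 1) n : ℂ)

/-- The generating function is $g(x)=\sum_r(-\zeta)^r(1-x)^{-\alpha r-1}$. Multiplying by
$(1-x)^\alpha$ shifts the index $r$, so $(1-x)^\alpha g=(1-x)^{\alpha-1}-\zeta g$; this is the
coefficient of $x^N$. -/
lemma gruenwald_recursion {α : ℝ} {ζ : ℂ} {N : ℕ}
    (hsum : ∀ n ≤ N, Summable fun r : ℕ => (-ζ) ^ r * (risingCoeff (α * r + 1) n : ℂ)) :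
    ∑ p ∈ Finset.HasAntidiagonal.antidiagonal N, (risingCoeff (-α) p.1 : ℂ) * gruenwald α ζ p.2 =
      risingCoeff (1 - α) N - ζ * gruenwald α ζ N := by
  have h1 : ∀ p ∈ Finset.HasAntidiagonal.antidiagonal N, (risingCoeff (-α) p.1 : ℂ) * gruenwald α ζ p.2 =
      ∑' r : ℕ, (risingCoeff (-α) p.1 : ℂ) * ((-ζ) ^ r * (risingCoeff (α * r + 1) p.2 : ℂ)) :=
    fun p _ => (tsum_mul_left).symm
  have hle : ∀ p ∈ Finset.HasAntidiagonal.antidiagonal N, p.2 ≤ N := fun p hp =>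
    Finset.HasAntidiagonal.antidiagonal.snd_le hp
  rw [Finset.sum_congr rfl h1, ← Summable.tsum_finsetSum
    (fun p hp => (hsum p.2 (hle p hp)).mul_left _)]
  have h2 : ∀ r : ℕ, ∑ p ∈ Finset.HasAntidiagonal.antidiagonal N,
      (risingCoeff (-α) p.1 : ℂ) * ((-ζ) ^ r * (risingCoeff (α * r + 1) p.2 : ℂ)) =
      (-ζ) ^ r * (risingCoeff (α * r + 1 - α) N : ℂ) := by
    intro r
    rw [show α * r + 1 - α = -α + (α * r + 1) by ring, ← sum_antidiagonal_risingCoeff]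
    push_cast
    rw [Finset.mul_sum]
    exact Finset.sum_congr rfl fun p _ => by ring
  have h3 : Summable fun r : ℕ => (-ζ) ^ (r + 1) * (risingCoeff (α * (r + 1 : ℕ) + 1 - α) N : ℂ) := by
    refine ((hsum N le_rfl).mul_left (-ζ)).congr fun r => ?_
    rw [show α * ((r + 1 : ℕ) : ℝ) + 1 - α = α * r + 1 by push_cast; ring]
    ring
  simp_rw [h2]
  rw [((summable_nat_add_iff (f := fun r : ℕ =>
    (-ζ) ^ r * (risingCoeff (α * r + 1 - α) N : ℂ)) 1).1 h3).tsum_eq_zero_add, gruenwald,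
    ← tsum_mul_left, sub_eq_add_neg (risingCoeff (1 - α) N : ℂ), ← tsum_neg]
  congr 1
  · simp
  · refine tsum_congr fun r => ?_
    rw [show α * ((r + 1 : ℕ) : ℝ) + 1 - α = α * r + 1 by push_cast; ring]
    ring

/-- Stability of the implicit scheme: solved for the newest value, the recursion gives
$(1+\zeta)g_n$ as a sum with nonnegative weights `risingCoeff (1 - α) n` (on the constant $1$) and
`-risingCoeff (-α) (k + 1)` (on earlier values). These add up to one by `sum_range_risingCoeff`,
while $|1+\zeta|\ge1$. -/
lemma norm_gruenwald_le_one {α : ℝ} (hα0 : 0 ≤ α) (hα1 : α ≤ 1) {ζ : ℂ} (hζ : 0 ≤ ζ.re) {N : ℕ}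
    (hsum : ∀ n ≤ N, Summable fun r : ℕ => (-ζ) ^ r * (risingCoeff (α * r + 1) n : ℂ)) :
    ∀ n ≤ N, ‖gruenwald α ζ n‖ ≤ 1 := by
  intro n
  induction n using Nat.strong_induction_on with
  | _ n ih =>
    intro hn
    have hrec := gruenwald_recursion (N := n) fun m hm => hsum m (hm.trans hn)
    have hone : (1 : ℝ) ≤ ‖1 + ζ‖ := by
      refine le_trans ?_ (Complex.re_le_norm _)
      simpa using hζ
    have hpart : ∑ j ∈ Finset.range (n + 1), risingCoeff (-α) j = risingCoeff (1 - α) n := by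
      rw [sum_range_risingCoeff, neg_add_eq_sub]
    rw [Finset.Nat.sum_antidiagonal_eq_sum_range_succ_mk, Finset.sum_range_succ'] at hrec
    rw [Finset.sum_range_succ'] at hpart
    simp only [risingCoeff_zero, Complex.ofReal_one, one_mul, Nat.sub_zero] at hrec hpart
    have hkey : (1 + ζ) * gruenwald α ζ n = risingCoeff (1 - α) n +
        ∑ k ∈ Finset.range n, (-(risingCoeff (-α) (k + 1)) : ℂ) * gruenwald α ζ (n - (k + 1)) := by
      simp only [neg_mul, Finset.sum_neg_distrib]
      linear_combination hrec
    have hb : ‖(1 + ζ) * gruenwald α ζ n‖ ≤ 1 := by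
      rw [hkey]
      refine (norm_add_le _ _).trans ?_
      have h1 : ‖(risingCoeff (1 - α) n : ℂ)‖ = risingCoeff (1 - α) n := by
        rw [Complex.norm_real, Real.norm_of_nonneg (risingCoeff_nonneg (by linarith) n)]
      have h2 : ‖∑ k ∈ Finset.range n,
          (-(risingCoeff (-α) (k + 1)) : ℂ) * gruenwald α ζ (n - (k + 1))‖ ≤
          ∑ k ∈ Finset.range n, -risingCoeff (-α) (k + 1) := by
        refine norm_sum_le_of_le _ fun k hk => ?_
        have hk' := Finset.mem_range.1 hk
        rw [norm_mul, norm_neg, Complex.norm_real, Real.norm_of_nonpos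
          (risingCoeff_neg_succ_nonpos hα0 hα1 k)]
        exact mul_le_of_le_one_right (neg_nonneg.2 (risingCoeff_neg_succ_nonpos hα0 hα1 k))
          (ih _ (by omega) (by omega))
      rw [Finset.sum_neg_distrib] at h2
      linarith
    rw [norm_mul] at hb
    nlinarith [norm_nonneg (gruenwald α ζ n)]

/-- Euler's limit formula for $\Gamma(s)$, inverted. The case $s=0$ is separate because $\Gamma$ has
a pole there. -/
lemma tendsto_risingCoeff_mul_rpow {s : ℝ} (hs : 0 ≤ s) :
    Tendsto (fun n : ℕ => risingCoeff (s + 1) n * (n : ℝ) ^ (-s)) atTop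
      (𝓝 (Real.Gamma (s + 1))⁻¹) := by
  rcases hs.eq_or_lt with rfl | hs
  · simp [risingCoeff_one]
  · have h := ((Real.GammaSeq_tendsto_Gamma s).const_mul s).inv₀
      (mul_ne_zero hs.ne' (Real.Gamma_pos_of_pos hs).ne')
    rw [Real.Gamma_add_one hs.ne']
    refine h.congr' ?_
    filter_upwards [eventually_gt_atTop 0] with n hn
    have hn' : (0 : ℝ) < (n : ℝ) ^ s := by positivity
    have hp : ∏ j ∈ Finset.range (n + 1), (s + j) = s * (n.factorial * risingCoeff (s + 1) n) := by
      rw [Finset.prod_range_succ', risingCoeff, Finset.prod_div_distrib,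
        ← Finset.prod_range_add_one_eq_factorial]
      push_cast
      rw [mul_div_cancel₀ _ (by positivity)]
      simp only [add_zero, mul_comm s, add_assoc, add_comm (1 : ℝ)]
    have h0 : 0 < risingCoeff (s + 1) n := Finset.prod_pos fun j _ => by positivity
    rw [Real.GammaSeq, hp, Real.rpow_neg (by positivity)]
    field_simp

/-- The Mittag-Leffler function `E_α`, `0 < α ≤ 1`, is bounded by one on the closed left
half-plane. -/
theorem norm_mittagLeffler_neg_le_one {α : ℝ} (hα0 : 0 < α) (hα1 : α ≤ 1) {z : ℂ}
    (hz : 0 ≤ z.re) : ‖mittagLeffler α 1 (-z)‖ ≤ 1 := by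
  -- The scheme is run with $\zeta_n=zn^{-\alpha}$, that is, step $1/n$ up to time one. Applying
  -- `risingCoeff_mul_le` at $y=A/n$ bounds the $r$-th term by $(|z|A^{-\alpha})^r$ times a factor
  -- free of $r$, so this $A$ gives a geometric majorant of ratio $1/2$.
  obtain ⟨A, hA1, hA⟩ : ∃ A : ℝ, 1 ≤ A ∧ ‖z‖ * A ^ (-α) ≤ 1 / 2 := by
    have h : Tendsto (fun A : ℝ => ‖z‖ * A ^ (-α)) atTop (𝓝 (‖z‖ * 0)) :=
      (tendsto_rpow_neg_atTop hα0).const_mul _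
    rw [mul_zero] at h
    exact ((eventually_ge_atTop 1).and (h.eventually (eventually_le_nhds (by norm_num)))).exists
  have hA0 : 0 < A := by linarith
  -- the scaled terms and their uniform bound
  set ζ : ℕ → ℂ := fun n => z * (((n : ℝ) ^ (-α) : ℝ) : ℂ) with hζ
  have hbound : ∀ n m : ℕ, 2 * A ≤ n → m ≤ n → ∀ r : ℕ,
      ‖(-ζ n) ^ r * (risingCoeff (α * r + 1) m : ℂ)‖ ≤
        (1 - A / n)⁻¹ ^ m * (1 / 2) ^ r := by
    intro n m hn hm r
    have hn0 : (0 : ℝ) < n := by linarith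
    have hy0 : 0 < A / n := by positivity
    have hy1 : A / n ≤ 1 / 2 := by rw [div_le_iff₀ hn0]; linarith
    have hpos : 0 < 1 - A / n := by linarith
    have hs : 0 ≤ α * r := by positivity
    have hc := risingCoeff_mul_le hs m hy0 (by linarith)
    rw [norm_mul, norm_pow, norm_neg, Complex.norm_real,
      Real.norm_of_nonneg (risingCoeff_nonneg (by linarith) m), inv_pow, ← div_eq_inv_mul,
      le_div_iff₀ (by positivity), mul_assoc]
    refine (mul_le_mul_of_nonneg_left hc (by positivity)).trans ?_
    have hζn : ‖ζ n‖ = ‖z‖ * (n : ℝ) ^ (-α) := by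
      rw [hζ, norm_mul, Complex.norm_real, Real.norm_of_nonneg (by positivity)]
    have e1 : (A / n) ^ (-(α * r)) = ((A / n) ^ (-α)) ^ r := by
      rw [← Real.rpow_natCast, ← Real.rpow_mul hy0.le, neg_mul]
    rw [e1, ← mul_pow, hζn]
    refine pow_le_pow_left₀ (by positivity) ?_ r
    rw [mul_assoc, ← Real.mul_rpow hn0.le hy0.le, mul_div_cancel₀ _ hn0.ne']
    exact hA
  have hsummable : ∀ n m : ℕ, 2 * A ≤ n → m ≤ n →
      Summable fun r : ℕ => (-ζ n) ^ r * (risingCoeff (α * r + 1) m : ℂ) := fun n m hn hm =>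
    Summable.of_norm_bounded ((summable_geometric_of_lt_one (by norm_num)
      (by norm_num : (1 / 2 : ℝ) < 1)).mul_left _) (hbound n m hn hm)
  have hle : ∀ n : ℕ, 2 * A ≤ n → ‖gruenwald α (ζ n) n‖ ≤ 1 := fun n hn =>
    norm_gruenwald_le_one hα0.le hα1 (by
      rw [hζ, Complex.re_mul_ofReal]; exact mul_nonneg hz (by positivity))
      (fun m hm => hsummable n m hn hm) n le_rfl
  have hlim : Tendsto (fun n => gruenwald α (ζ n) n) atTop (𝓝 (mittagLeffler α 1 (-z))) := by
    refine tendsto_tsum_of_dominated_convergence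
      (bound := fun r : ℕ => Real.exp (2 * A) * (1 / 2) ^ r)
      ((summable_geometric_of_lt_one (by norm_num) (by norm_num)).mul_left _) ?_ ?_
    · intro r
      have h := (tendsto_risingCoeff_mul_rpow (s := α * r) (by positivity))
      have h' := ((Complex.continuous_ofReal.tendsto _).comp h).const_mul ((-z) ^ r)
      rw [div_eq_mul_inv, ← Complex.ofReal_inv]
      refine h'.congr fun n => ?_
      have e : (-ζ n) ^ r = (-z) ^ r * (((n : ℝ) ^ (-(α * r)) : ℝ) : ℂ) := by
        rw [hζ, ← neg_mul, mul_pow, ← Complex.ofReal_pow, ← Real.rpow_natCast,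
          ← Real.rpow_mul (by positivity), neg_mul]
      rw [e, Function.comp_apply]
      push_cast
      ring
    · filter_upwards [eventually_ge_atTop ⌈2 * A⌉₊] with n hn r
      have hn' : 2 * A ≤ n := Nat.ceil_le.1 hn
      have hn0 : (0 : ℝ) < n := by linarith
      have hy1 : A / n ≤ 1 / 2 := by rw [div_le_iff₀ hn0]; linarith
      have hy0 : 0 < A / n := by positivity
      refine (hbound n n hn' le_rfl r).trans (mul_le_mul_of_nonneg_right ?_ (by positivity))
      -- For $0\le u\le\frac12$ one has $(1-u)^{-1}\le1+2u\le e^{2u}$. The $n$-th power is then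
      -- bounded by $e^{2A}$, uniformly in $n$, as dominated convergence requires.
      have h1 : (1 - A / n)⁻¹ ≤ Real.exp (2 * A / n) := by
        rw [inv_le_comm₀ (by linarith) (Real.exp_pos _), ← Real.exp_neg]
        have h2 : 1 + 2 * A / n ≤ Real.exp (2 * A / n) := by
          linarith [Real.add_one_le_exp (2 * A / n)]
        rw [Real.exp_neg, inv_le_comm₀ (Real.exp_pos _) (by linarith)]
        refine le_trans ?_ h2
        rw [inv_le_iff_one_le_mul₀ (by linarith), mul_div_assoc]
        nlinarith
      calc (1 - A / n)⁻¹ ^ n ≤ Real.exp (2 * A / n) ^ n :=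
            pow_le_pow_left₀ (inv_nonneg.2 (by linarith)) h1 n
        _ = Real.exp (2 * A) := by
            rw [← Real.exp_nat_mul, mul_div_cancel₀ _ hn0.ne']
  refine le_of_tendsto hlim.norm ?_
  filter_upwards [eventually_ge_atTop ⌈2 * A⌉₊] with n hn using hle n (Nat.ceil_le.1 hn)

lemma conj_mittagLeffler (a b : ℝ) (z : ℂ) :
    (starRingEnd ℂ) (mittagLeffler a b z) = mittagLeffler a b ((starRingEnd ℂ) z) := by
  rw [mittagLeffler, Complex.conj_tsum]
  simp [mittagLeffler]

/-! ### The time factors are real and bounded -/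

lemma conj_M (c γ k : ℝ) (ℓ : ℕ) :
    (starRingEnd ℂ) (M c γ k ℓ) = M c γ k ℓ ∨ (starRingEnd ℂ) (M c γ k ℓ) = -M c γ k ℓ := by
  unfold M
  split_ifs
  · exact Or.inl (Complex.conj_ofReal _)
  · right; simp

/-- Conjugation either fixes $M_\ell$ or changes its sign. In the second case it exchanges
$z_\ell^+$ and $z_\ell^-$: $F^{(1)}$ is symmetric, and in $F^{(2)}$ numerator and denominator both
change sign. -/
lemma conj_F1_add_F2 (c γ k α : ℝ) (ℓ : ℕ) (t : ℝ) :
    (starRingEnd ℂ) (F1 c γ k α ℓ t + F2 c γ k α ℓ t) = F1 c γ k α ℓ t + F2 c γ k α ℓ t := by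
  simp only [F1, F2, zPlus, zMinus, map_add, map_sub, map_div₀, map_mul, map_neg, map_one,
    conj_mittagLeffler, Complex.conj_ofReal, map_ofNat]
  rcases conj_M c γ k ℓ with h | h
  · rw [h]
  · rw [h, sub_neg_eq_add, ← sub_eq_add_neg, mul_neg, div_neg]
    ring

lemma im_F (c γ k α : ℝ) (ℓ : ℕ) (t : ℝ) : (F c γ k α ℓ t).im = 0 := by
  rw [← Complex.conj_eq_iff_im, F]
  split_ifs
  · exact conj_F1_add_F2 c γ k α ℓ t
  · simp only [zCrit, map_mul, map_add, map_neg, map_one, conj_mittagLeffler, Complex.conj_ofReal]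

lemma im_FLim (c γ k α : ℝ) (ℓ : ℕ) (t : ℝ) : (FLim c γ k α ℓ t).im = 0 := by
  rw [← Complex.conj_eq_iff_im, FLim]
  split_ifs
  · exact conj_F1_add_F2 c γ k α ℓ t
  · simp only [zCrit, map_mul, map_add, map_neg, conj_mittagLeffler, Complex.conj_ofReal]

/-- Beyond $\varkappa$ the real part of $z_\ell^\pm$ is $c^2/(2\gamma)>0$, so all Mittag-Leffler
values are at most one in modulus. The requirement $\ell\ge2\omega^2$ gives
$\lambda_\ell\omega^{-2}\ge2$, hence $|M_\ell|\ge1$, which controls the denominator of $F^{(2)}$. -/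
lemma eventually_norm_F1_add_F2_le {c γ k α : ℝ} (hc : 0 < c) (hγ : 0 < γ) (hk : 0 < k)
    (hα : 0 < α) (hα1 : α ≤ 1) {t : ℝ} (ht : 0 ≤ t) :
    ∀ᶠ ℓ : ℕ in atTop, (ℓ : ℝ) ≠ kappa c γ k ∧ ‖F1 c γ k α ℓ t + F2 c γ k α ℓ t‖ ≤ 2 := by
  have hω : 0 < omega c γ k ^ 2 := by unfold omega; positivity
  filter_upwards [(tendsto_natCast_atTop_atTop (R := ℝ)).eventually_gt_atTop (kappa c γ k),
    (tendsto_natCast_atTop_atTop (R := ℝ)).eventually_ge_atTop (2 * omega c γ k ^ 2),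
    eventually_ge_atTop 1] with ℓ h1 h2 h3
  refine ⟨h1.ne', ?_⟩
  have hℓ : (1 : ℝ) ≤ ℓ := by exact_mod_cast h3
  have hM : M c γ k ℓ =
      Complex.I * ((Real.sqrt (eigen ℓ * (omega c γ k ^ 2)⁻¹ - 1) : ℝ) : ℂ) := if_neg h1.not_ge
  have hMre : (M c γ k ℓ).re = 0 := by rw [hM]; simp
  have hMnorm : 1 ≤ ‖M c γ k ℓ‖ := by
    rw [hM, norm_mul, Complex.norm_I, one_mul, Complex.norm_real, Real.norm_of_nonneg
      (Real.sqrt_nonneg _), Real.one_le_sqrt, ← div_eq_mul_inv, le_sub_iff_add_le,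
      le_div_iff₀ hω, eigen]
    nlinarith
  have hE : ∀ w : ℂ, w.re = 0 → ‖mittagLeffler α 1
      (-(((c ^ 2 / (2 * γ) : ℝ) : ℂ) * (1 + w)) * ((t ^ α : ℝ) : ℂ))‖ ≤ 1 := by
    intro w hw
    rw [neg_mul]
    refine norm_mittagLeffler_neg_le_one hα hα1 ?_
    rw [Complex.re_mul_ofReal, Complex.re_ofReal_mul, Complex.add_re, hw, Complex.one_re, add_zero,
      mul_one]
    positivity
  have hp := hE _ hMre
  have hm := hE (-M c γ k ℓ) (by simp [hMre])
  rw [← sub_eq_add_neg] at hm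
  have hF1 : ‖F1 c γ k α ℓ t‖ ≤ 1 := by
    rw [F1, norm_div, Complex.norm_ofNat, div_le_one (by norm_num)]
    exact (norm_add_le _ _).trans (by unfold zMinus zPlus; linarith)
  have hF2 : ‖F2 c γ k α ℓ t‖ ≤ 1 := by
    rw [F2, norm_div, norm_mul, Complex.norm_ofNat, div_le_one (by positivity)]
    exact (norm_sub_le _ _).trans (by unfold zMinus zPlus; linarith)
  exact (norm_add_le _ _).trans (by linarith)

lemma exists_bound_of_eventually {E : Type*} [SeminormedAddCommGroup E] {f : ℕ → E} {C : ℝ}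
    (h : ∀ᶠ n in atTop, ‖f n‖ ≤ C) : ∃ B, 0 ≤ B ∧ ∀ n, ‖f n‖ ≤ B := by
  obtain ⟨B, hB⟩ := (isBoundedUnder_of_eventually_le h).bddAbove_range
  exact ⟨max B 0, le_max_right _ _, fun n => (hB ⟨n, rfl⟩).trans (le_max_left _ _)⟩

lemma exists_norm_timeFactor_le {c γ k α : ℝ} (hc : 0 < c) (hγ : 0 < γ) (hk : 0 < k)
    (hα : 0 < α) (hα1 : α ≤ 1) {t : ℝ} (ht : 0 ≤ t) {G : ℕ → ℝ → ℂ}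
    (hG : G = F c γ k α ∨ G = FLim c γ k α) : ∃ B, 0 ≤ B ∧ ∀ ℓ, ‖G ℓ t‖ ≤ B := by
  refine exists_bound_of_eventually (C := 2) ?_
  filter_upwards [eventually_norm_F1_add_F2_le hc hγ hk hα hα1 ht] with ℓ hℓ
  rcases hG with rfl | rfl
  · rw [F, if_pos hℓ.1]; exact hℓ.2
  · rw [FLim, if_pos hℓ.1]; exact hℓ.2

/-! ### Legendre polynomials -/

section Legendre

open Polynomial

/-- The polynomial $u=(X^2-1)^\ell$ satisfies $(X^2-1)u'=2\ell Xu$; this is that equation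
differentiated $n+1$ times. -/
lemma iterate_derivative_X_sq_sub_one_pow (ℓ n : ℕ) :
    (X ^ 2 - 1 : ℝ[X]) * derivative^[n + 2] ((X ^ 2 - 1) ^ ℓ) +
      (2 * (n + 1) - 2 * ℓ : ℝ[X]) * X * derivative^[n + 1] ((X ^ 2 - 1) ^ ℓ) +
      ((n + 1) * (n - 2 * ℓ) : ℝ[X]) * derivative^[n] ((X ^ 2 - 1) ^ ℓ) = 0 := by
  induction n with
  | zero =>
    have h : (X ^ 2 - 1 : ℝ[X]) * derivative ((X ^ 2 - 1) ^ ℓ) = (2 * ℓ : ℝ[X]) * X * (X ^ 2 - 1) ^ ℓ := by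
      rcases ℓ with _ | ℓ
      · simp
      · rw [derivative_pow_succ]
        simp
        ring
    have h' := congrArg derivative h
    simp only [derivative_mul, derivative_sub, derivative_X_pow, derivative_one, derivative_X,
      derivative_natCast, derivative_ofNat] at h'
    simp only [zero_add, Function.iterate_succ, Function.iterate_zero, Function.comp_apply, id]
    simp only [Nat.cast_ofNat, map_ofNat, Nat.cast_zero] at h' ⊢
    linear_combination h'
  | succ n ih =>
    have h' := congrArg derivative ih
    simp only [derivative_mul, derivative_sub, derivative_add, derivative_X_pow, derivative_one,
      derivative_X, derivative_natCast, derivative_ofNat, derivative_zero,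
      ← Function.iterate_succ_apply' (f := derivative)] at h'
    simp only [Nat.cast_ofNat, map_ofNat, Nat.cast_succ] at h' ⊢
    linear_combination h'

/-- The `j`-th derivative of the Legendre polynomial of degree `ℓ`. -/
def legendreDeriv (ℓ j : ℕ) : ℝ[X] := derivative^[j] (legendre ℓ)

lemma derivative_legendreDeriv (ℓ j : ℕ) :
    derivative (legendreDeriv ℓ j) = legendreDeriv ℓ (j + 1) :=
  (Function.iterate_succ_apply' _ _ _).symm

lemma legendreDeriv_eq (ℓ j : ℕ) : legendreDeriv ℓ j =
    C (1 / (2 ^ ℓ * (ℓ.factorial : ℝ))) * derivative^[ℓ + j] ((X ^ 2 - 1) ^ ℓ) := by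
  rw [legendreDeriv, legendre, iterate_derivative_C_mul, add_comm ℓ j, Function.iterate_add_apply]

/-- The derivatives of the Legendre differential equation. -/
lemma legendreDeriv_ode (ℓ j : ℕ) (u : ℝ) :
    (1 - u ^ 2) * (legendreDeriv ℓ (j + 2)).eval u -
      2 * (j + 1) * u * (legendreDeriv ℓ (j + 1)).eval u =
      -((ℓ + j + 1) * (ℓ - j)) * (legendreDeriv ℓ j).eval u := by
  have h := congrArg (eval u) (iterate_derivative_X_sq_sub_one_pow ℓ (ℓ + j))
  simp only [eval_add, eval_mul, eval_sub, eval_pow, eval_X, eval_one, eval_natCast, eval_ofNat,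
    eval_zero, Nat.cast_add] at h
  simp only [legendreDeriv_eq, eval_mul, eval_C, ← add_assoc]
  linear_combination -(1 / (2 ^ ℓ * (ℓ.factorial : ℝ))) * h

lemma legendreDeriv_eq_zero {ℓ j : ℕ} (h : ℓ < j) : legendreDeriv ℓ j = 0 := by
  refine iterate_derivative_eq_zero (lt_of_le_of_lt ?_ h)
  have h1 : ((X ^ 2 - 1 : ℝ[X]) ^ ℓ).natDegree ≤ 2 * ℓ := by
    refine natDegree_pow_le.trans ?_
    rw [mul_comm]
    refine Nat.mul_le_mul_right _ ?_
    compute_degree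
  refine (natDegree_C_mul_le _ _).trans ((natDegree_iterate_derivative _ _).trans ?_)
  omega

/-- Since $(X^2-1)^\ell=(X-1)^\ell(X+1)^\ell$, the $\ell$-th derivative at $1$ is $\ell!\,2^\ell$.
-/
lemma eval_legendre_one (ℓ : ℕ) : (legendre ℓ).eval 1 = 1 := by
  have hp : (X ^ 2 - 1 : ℝ[X]) ^ ℓ = (X - C 1) ^ ℓ * (X + 1) ^ ℓ := by
    rw [← mul_pow]; congr 1; simp; ring
  have h := aeval_iterate_derivative_self ((X ^ 2 - 1 : ℝ[X]) ^ ℓ) ℓ (1 : ℝ)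
    (p' := (X + 1) ^ ℓ) (by simpa using hp)
  rw [coe_aeval_eq_eval] at h
  rw [legendre, eval_mul, eval_C, h]
  have : ((ℓ.factorial : ℝ)) ≠ 0 := by positivity
  simp
  field_simp
  norm_num

end Legendre

/-! ### Rotations about the coordinate axes -/

lemma normSq_E3 (x : E3) : ‖x‖ ^ 2 = x 0 ^ 2 + x 1 ^ 2 + x 2 ^ 2 := by
  rw [EuclideanSpace.norm_sq_eq, Fin.sum_univ_three]
  simp

/-- The rotation by `θ` in the plane of the first and the third coordinate. -/
def rotY (θ : ℝ) : E3 ≃ₗᵢ[ℝ] E3 where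
  toFun x := !₂[Real.cos θ * x 0 + Real.sin θ * x 2, x 1, -Real.sin θ * x 0 + Real.cos θ * x 2]
  invFun x := !₂[Real.cos θ * x 0 - Real.sin θ * x 2, x 1, Real.sin θ * x 0 + Real.cos θ * x 2]
  map_add' x y := by ext i; fin_cases i <;> simp <;> ring
  map_smul' a x := by ext i; fin_cases i <;> simp <;> ring
  left_inv x := by
    ext i
    fin_cases i <;> simp
    · linear_combination x 0 * Real.sin_sq_add_cos_sq θ
    · linear_combination x 2 * Real.sin_sq_add_cos_sq θ
  right_inv x := by
    ext i
    fin_cases i <;> simp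
    · linear_combination x 0 * Real.sin_sq_add_cos_sq θ
    · linear_combination x 2 * Real.sin_sq_add_cos_sq θ
  norm_map' x := by
    rw [← sq_eq_sq₀ (norm_nonneg _) (norm_nonneg _), normSq_E3, normSq_E3]
    simp
    linear_combination (x 0 ^ 2 + x 2 ^ 2) * Real.sin_sq_add_cos_sq θ

/-- The rotation by `θ` about the third coordinate axis. -/
def rotZ (θ : ℝ) : E3 ≃ₗᵢ[ℝ] E3 where
  toFun x := !₂[Real.cos θ * x 0 - Real.sin θ * x 1, Real.sin θ * x 0 + Real.cos θ * x 1, x 2]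
  invFun x := !₂[Real.cos θ * x 0 + Real.sin θ * x 1, -Real.sin θ * x 0 + Real.cos θ * x 1, x 2]
  map_add' x y := by ext i; fin_cases i <;> simp <;> ring
  map_smul' a x := by ext i; fin_cases i <;> simp <;> ring
  left_inv x := by
    ext i
    fin_cases i <;> simp
    · linear_combination x 0 * Real.sin_sq_add_cos_sq θ
    · linear_combination x 1 * Real.sin_sq_add_cos_sq θ
  right_inv x := by
    ext i
    fin_cases i <;> simp
    · linear_combination x 0 * Real.sin_sq_add_cos_sq θ
    · linear_combination x 1 * Real.sin_sq_add_cos_sq θ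
  norm_map' x := by
    rw [← sq_eq_sq₀ (norm_nonneg _) (norm_nonneg _), normSq_E3, normSq_E3]
    simp
    linear_combination (x 0 ^ 2 + x 1 ^ 2) * Real.sin_sq_add_cos_sq θ

lemma rotY_apply (θ : ℝ) (x : E3) : rotY θ x =
    !₂[Real.cos θ * x 0 + Real.sin θ * x 2, x 1, -Real.sin θ * x 0 + Real.cos θ * x 2] := rfl

lemma rotZ_apply (θ : ℝ) (x : E3) : rotZ θ x =
    !₂[Real.cos θ * x 0 - Real.sin θ * x 1, Real.sin θ * x 0 + Real.cos θ * x 1, x 2] := rfl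

lemma isRotation_rotY (θ : ℝ) : IsRotation (rotY θ) := by
  rw [IsRotation, ← LinearMap.det_toMatrix (EuclideanSpace.basisFun (Fin 3) ℝ).toBasis,
    Matrix.det_fin_three]
  simp [LinearMap.toMatrix_apply, rotY_apply]
  linear_combination Real.sin_sq_add_cos_sq θ

lemma isRotation_rotZ (θ : ℝ) : IsRotation (rotZ θ) := by
  rw [IsRotation, ← LinearMap.det_toMatrix (EuclideanSpace.basisFun (Fin 3) ℝ).toBasis,
    Matrix.det_fin_three]
  simp [LinearMap.toMatrix_apply, rotZ_apply]
  linear_combination Real.sin_sq_add_cos_sq θ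

/-- The third coordinate on the sphere. -/
def height (x : S2) : ℝ := (x : E3) 2

/-- The projection of the sphere to the plane of the first two coordinates. -/
def planar (x : S2) : ℂ := ⟨(x : E3) 0, (x : E3) 1⟩

lemma sphere_coord (x : S2) : (x : E3) 0 ^ 2 + (x : E3) 1 ^ 2 + (x : E3) 2 ^ 2 = 1 := by
  rw [← normSq_E3, norm_eq_of_mem_sphere]; norm_num

lemma planar_mul_conj (x : S2) :
    planar x * (starRingEnd ℂ) (planar x) = ((1 - height x ^ 2 : ℝ) : ℂ) := by
  rw [Complex.mul_conj, Complex.normSq_apply]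
  congr 1
  simp only [planar, height]
  linear_combination sphere_coord x

/-- The north pole. -/
def northPole : S2 := ⟨!₂[0, 0, 1], by simp [EuclideanSpace.norm_eq, Fin.sum_univ_three]⟩

lemma height_northPole : height northPole = 1 := by simp [height, northPole]

lemma planar_northPole : planar northPole = 0 := by
  apply Complex.ext <;> simp [planar, northPole]

lemma eq_northPole {x : S2} (h0 : (x : E3) 0 = 0) (h1 : (x : E3) 1 = 0) (h2 : 0 ≤ (x : E3) 2) :
    x = northPole := by
  have h := sphere_coord x
  have h3 : (x : E3) 2 = 1 := by
    rw [h0, h1] at h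
    nlinarith
  apply Subtype.ext
  ext i
  fin_cases i <;> simp [northPole, h0, h1, h3]

lemma exists_cos_sin (a b : ℝ) : ∃ θ r : ℝ, 0 ≤ r ∧ a = r * Real.cos θ ∧ b = r * Real.sin θ :=
  ⟨Complex.arg ⟨a, b⟩, ‖(⟨a, b⟩ : ℂ)‖, norm_nonneg _,
    (Complex.norm_mul_cos_arg ⟨a, b⟩).symm, (Complex.norm_mul_sin_arg ⟨a, b⟩).symm⟩

/-- Euler angles: a turn about the third axis removes the second coordinate, a turn in the plane of
the first and third removes the first. The radius $q\ge0$ ensures that the north pole is reached and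
not the south pole. -/
lemma exists_rotate_eq_northPole (x : S2) :
    ∃ θ φ : ℝ, rotate (rotY θ) (rotate (rotZ φ) x) = northPole := by
  obtain ⟨φ, r, hr, h0, h1⟩ := exists_cos_sin ((x : E3) 0) ((x : E3) 1)
  obtain ⟨θ, q, hq, h2, h3⟩ := exists_cos_sin ((x : E3) 2) r
  refine ⟨-θ, -φ, eq_northPole ?_ ?_ ?_⟩
  · simp only [rotate, rotY_apply, rotZ_apply]
    simp
    rw [h0, h1, h2]
    linear_combination (r * Real.cos θ) * Real.sin_sq_add_cos_sq φ + Real.cos θ * h3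
  · simp only [rotate, rotY_apply, rotZ_apply]
    simp
    rw [h0, h1]
    ring
  · simp only [rotate, rotY_apply, rotZ_apply]
    simp
    rw [h0, h1, h2]
    have : Real.sin θ * (Real.cos φ * (r * Real.cos φ) + Real.sin φ * (r * Real.sin φ)) +
        Real.cos θ * (q * Real.cos θ) = q := by
      linear_combination (r * Real.sin θ) * Real.sin_sq_add_cos_sq φ + Real.sin θ * h3 +
        q * Real.sin_sq_add_cos_sq θ
    linarith

/-! ### The generators of the rotations -/

/-- `f'` is the derivative of `f` along the flow `ρ` on the sphere. -/
def IsGenerator (ρ : ℝ → E3 ≃ₗᵢ[ℝ] E3) (f f' : S2 → ℝ) : Prop :=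
  ∀ x θ, HasDerivAt (fun θ => f (rotate (ρ θ) x)) (f' (rotate (ρ θ) x)) θ

lemma hasDerivAt_height_rotY (x : S2) (θ : ℝ) :
    HasDerivAt (fun θ => height (rotate (rotY θ) x)) (-(planar (rotate (rotY θ) x)).re) θ := by
  simp only [height, planar, rotate, rotY_apply]
  simp
  have := (((Real.hasDerivAt_sin θ).mul_const ((x : E3) 0)).neg).add
    ((Real.hasDerivAt_cos θ).mul_const ((x : E3) 2))
  convert! this using 1
  ring

lemma hasDerivAt_planar_rotY (x : S2) (θ : ℝ) :
    HasDerivAt (fun θ => planar (rotate (rotY θ) x)) (height (rotate (rotY θ) x) : ℂ) θ := by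
  have e : ∀ θ, planar (rotate (rotY θ) x) =
      ((Real.cos θ * (x : E3) 0 + Real.sin θ * (x : E3) 2 : ℝ) : ℂ) + ((x : E3) 1 : ℂ) * Complex.I := by
    intro θ
    apply Complex.ext <;> simp [planar, rotate, rotY_apply, -Complex.ofReal_cos, -Complex.ofReal_sin]
  simp_rw [e]
  have := (((Real.hasDerivAt_cos θ).mul_const ((x : E3) 0)).add
    ((Real.hasDerivAt_sin θ).mul_const ((x : E3) 2))).ofReal_comp.add_const
      (((x : E3) 1 : ℂ) * Complex.I)
  convert! this using 1

lemma hasDerivAt_planar_rotZ (x : S2) (θ : ℝ) :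
    HasDerivAt (fun θ => planar (rotate (rotZ θ) x)) (Complex.I * planar (rotate (rotZ θ) x)) θ := by
  have e : ∀ θ, planar (rotate (rotZ θ) x) = Complex.exp (θ * Complex.I) * planar x := by
    intro θ
    rw [Complex.exp_mul_I, ← Complex.ofReal_cos, ← Complex.ofReal_sin]
    apply Complex.ext
    · simp [planar, rotate, rotZ_apply, -Complex.ofReal_cos, -Complex.ofReal_sin]
    · simp [planar, rotate, rotZ_apply, -Complex.ofReal_cos, -Complex.ofReal_sin]
      ring
  simp_rw [e]
  have := ((((hasDerivAt_id θ).ofReal_comp).mul_const Complex.I).cexp).mul_const (planar x)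
  convert! this using 1
  simp
  ring

lemma height_rotZ (x : S2) (θ : ℝ) : height (rotate (rotZ θ) x) = height x := by
  simp [height, rotate, rotZ_apply]

/-- The complex harmonic `P_ℓ^{(j)}(x₃) (x₁ + i x₂)^j`, not normalized. -/
def complexHarmonic (ℓ j : ℕ) (x : S2) : ℂ :=
  (((legendreDeriv ℓ j).eval (height x) : ℝ) : ℂ) * planar x ^ j

lemma continuous_height : Continuous height := by unfold height; fun_prop

lemma continuous_planar : Continuous planar := by
  have : planar = fun x : S2 => (((x : E3) 0 : ℝ) : ℂ) + (((x : E3) 1 : ℝ) : ℂ) * Complex.I := by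
    funext x
    apply Complex.ext <;> simp [planar]
  rw [this]
  fun_prop

lemma continuous_complexHarmonic (ℓ j : ℕ) : Continuous (complexHarmonic ℓ j) :=
  (Complex.continuous_ofReal.comp ((legendreDeriv ℓ j).continuous.comp continuous_height)).mul
    (continuous_planar.pow j)

lemma complexHarmonic_eq_zero {ℓ j : ℕ} (h : ℓ < j) : complexHarmonic ℓ j = 0 := by
  funext x; simp [complexHarmonic, legendreDeriv_eq_zero h]

lemma hasDerivAt_complexHarmonic_rotZ (ℓ j : ℕ) (x : S2) (θ : ℝ) :
    HasDerivAt (fun θ => complexHarmonic ℓ j (rotate (rotZ θ) x))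
      (j * Complex.I * complexHarmonic ℓ j (rotate (rotZ θ) x)) θ := by
  unfold complexHarmonic
  simp_rw [height_rotZ]
  have := ((hasDerivAt_planar_rotZ x θ).pow j).const_mul
    (((legendreDeriv ℓ j).eval (height x) : ℝ) : ℂ)
  convert! this using 1
  rcases j with _ | j
  · simp
  · simp [pow_succ]
    ring

lemma hasDerivAt_legendreDeriv_rotY (ℓ j : ℕ) (x : S2) (θ : ℝ) :
    HasDerivAt (fun θ => (legendreDeriv ℓ j).eval (height (rotate (rotY θ) x)))
      (-(legendreDeriv ℓ (j + 1)).eval (height (rotate (rotY θ) x)) *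
        (planar (rotate (rotY θ) x)).re) θ := by
  have := ((legendreDeriv ℓ j).hasDerivAt (height (rotate (rotY θ) x))).comp θ
    (hasDerivAt_height_rotY x θ)
  rw [derivative_legendreDeriv] at this
  convert! this using 1
  ring

/-- The ladder relation. With height $h$ and planar part $w$, the flow has $h'=-\mathrm{Re}\,w$ and
$w'=h$. Writing $\mathrm{Re}\,w=(w+\bar w)/2$, the $w$ half raises the order. In the $\bar w$ half,
$w\bar w=1-h^2$ turns what remains into the left side of the differentiated Legendre equation, which
lowers the order. -/
lemma hasDerivAt_complexHarmonic_rotY (ℓ j : ℕ) (x : S2) (θ : ℝ) :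
    HasDerivAt (fun θ => complexHarmonic ℓ (j + 1) (rotate (rotY θ) x))
      ((-complexHarmonic ℓ (j + 2) (rotate (rotY θ) x) +
        (((ℓ + j + 1) * (ℓ - j) : ℝ) : ℂ) * complexHarmonic ℓ j (rotate (rotY θ) x)) / 2) θ := by
  have h := ((hasDerivAt_legendreDeriv_rotY ℓ (j + 1) x θ).ofReal_comp).mul
    ((hasDerivAt_planar_rotY x θ).pow (j + 1))
  unfold complexHarmonic
  convert! h using 1
  set y := rotate (rotY θ) x
  have ode := congrArg (fun r : ℝ => (r : ℂ)) (legendreDeriv_ode ℓ j (height y))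
  have hw := planar_mul_conj y
  have hre : ((planar y).re : ℂ) = (planar y + (starRingEnd ℂ) (planar y)) / 2 :=
    Complex.re_eq_add_conj _
  push_cast at ode hw ⊢
  rw [hre]
  have hpow : ((fun θ => planar (rotate (rotY θ) x)) ^ (j + 1)) θ = planar y ^ (j + 1) := rfl
  rw [hpow]
  linear_combination (planar y ^ j / 2) * ode +
    ((((legendreDeriv ℓ (j + 2)).eval (height y) : ℝ) : ℂ) * planar y ^ j / 2) * hw

/-- The real part `P_{ℓ,j}(cos θ) cos (jφ)` of the complex harmonic. -/
def cosHarmonic (ℓ j : ℕ) : C(S2, ℝ) :=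
  ⟨fun x => (complexHarmonic ℓ j x).re, Complex.continuous_re.comp (continuous_complexHarmonic ℓ j)⟩

/-- The imaginary part `P_{ℓ,j}(cos θ) sin (jφ)` of the complex harmonic. -/
def sinHarmonic (ℓ j : ℕ) : C(S2, ℝ) :=
  ⟨fun x => (complexHarmonic ℓ j x).im, Complex.continuous_im.comp (continuous_complexHarmonic ℓ j)⟩

lemma cosHarmonic_apply (ℓ j : ℕ) (x : S2) :
    cosHarmonic ℓ j x = (complexHarmonic ℓ j x).re := rfl

lemma sinHarmonic_apply (ℓ j : ℕ) (x : S2) :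
    sinHarmonic ℓ j x = (complexHarmonic ℓ j x).im := rfl

lemma sinHarmonic_zero_right (ℓ : ℕ) : sinHarmonic ℓ 0 = 0 := by
  ext x; simp [sinHarmonic_apply, complexHarmonic]

lemma cosHarmonic_zero_right (ℓ : ℕ) (x : S2) :
    cosHarmonic ℓ 0 x = (legendre ℓ).eval (height x) := by
  simp [cosHarmonic_apply, complexHarmonic, legendreDeriv]

lemma cosHarmonic_of_lt {ℓ j : ℕ} (h : ℓ < j) : cosHarmonic ℓ j = 0 := by
  ext x; simp [cosHarmonic_apply, complexHarmonic_eq_zero h]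

lemma sinHarmonic_of_lt {ℓ j : ℕ} (h : ℓ < j) : sinHarmonic ℓ j = 0 := by
  ext x; simp [sinHarmonic_apply, complexHarmonic_eq_zero h]

lemma hasDerivAt_re {f : ℝ → ℂ} {f' : ℂ} {θ : ℝ} (h : HasDerivAt f f' θ) :
    HasDerivAt (fun θ => (f θ).re) f'.re θ :=
  Complex.reCLM.hasFDerivAt.comp_hasDerivAt θ h

lemma hasDerivAt_im {f : ℝ → ℂ} {f' : ℂ} {θ : ℝ} (h : HasDerivAt f f' θ) :
    HasDerivAt (fun θ => (f θ).im) f'.im θ :=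
  Complex.imCLM.hasFDerivAt.comp_hasDerivAt θ h

lemma isGenerator_rotZ_cosHarmonic (ℓ j : ℕ) :
    IsGenerator rotZ (cosHarmonic ℓ j) ⇑(-(j : ℝ) • sinHarmonic ℓ j) := fun x θ => by
  convert! hasDerivAt_re (hasDerivAt_complexHarmonic_rotZ ℓ j x θ) using 1
  simp [sinHarmonic_apply]

lemma isGenerator_rotZ_sinHarmonic (ℓ j : ℕ) :
    IsGenerator rotZ (sinHarmonic ℓ j) ⇑((j : ℝ) • cosHarmonic ℓ j) := fun x θ => by
  convert! hasDerivAt_im (hasDerivAt_complexHarmonic_rotZ ℓ j x θ) using 1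
  simp [cosHarmonic_apply]

/-- The square of the factor by which the ladder operator raises the `j`-th harmonic. -/
def ladderCoeff (ℓ j : ℕ) : ℝ := (ℓ + j + 1) * (ℓ - j)

lemma isGenerator_rotY_cosHarmonic_succ (ℓ j : ℕ) :
    IsGenerator rotY (cosHarmonic ℓ (j + 1))
      ⇑((1 / 2 : ℝ) • (ladderCoeff ℓ j • cosHarmonic ℓ j - cosHarmonic ℓ (j + 2))) := fun x θ => by
  convert! hasDerivAt_re (hasDerivAt_complexHarmonic_rotY ℓ j x θ) using 1
  rw [Complex.div_ofNat_re, Complex.add_re, Complex.re_ofReal_mul]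
  simp [cosHarmonic_apply, ladderCoeff]
  ring

lemma isGenerator_rotY_sinHarmonic_succ (ℓ j : ℕ) :
    IsGenerator rotY (sinHarmonic ℓ (j + 1))
      ⇑((1 / 2 : ℝ) • (ladderCoeff ℓ j • sinHarmonic ℓ j - sinHarmonic ℓ (j + 2))) := fun x θ => by
  convert! hasDerivAt_im (hasDerivAt_complexHarmonic_rotY ℓ j x θ) using 1
  rw [Complex.div_ofNat_im, Complex.add_im, Complex.im_ofReal_mul]
  simp [sinHarmonic_apply, ladderCoeff]
  ring

lemma isGenerator_rotY_cosHarmonic_zero (ℓ : ℕ) :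
    IsGenerator rotY (cosHarmonic ℓ 0) ⇑(-cosHarmonic ℓ 1) := fun x θ => by
  simp_rw [cosHarmonic_zero_right]
  convert! hasDerivAt_legendreDeriv_rotY ℓ 0 x θ using 1
  simp [cosHarmonic_apply, complexHarmonic]

/-! ### Rotation-invariant bilinear forms -/

/-- A symmetric bilinear form on continuous functions that is infinitesimally invariant under the
rotations `rotY` and `rotZ`. -/
structure IsInvariantForm (β : C(S2, ℝ) →ₗ[ℝ] C(S2, ℝ) →ₗ[ℝ] ℝ) : Prop where
  symm : ∀ f g, β f g = β g f
  rotZ : ∀ f f' g g' : C(S2, ℝ), IsGenerator rotZ f f' → IsGenerator rotZ g g' →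
    β f' g + β f g' = 0
  rotY : ∀ f f' g g' : C(S2, ℝ), IsGenerator rotY f f' → IsGenerator rotY g g' →
    β f' g + β f g' = 0

namespace IsInvariantForm

variable {β : C(S2, ℝ) →ₗ[ℝ] C(S2, ℝ) →ₗ[ℝ] ℝ}

lemma rotZ_cos_cos (hβ : IsInvariantForm β) (ℓ j ℓ' j' : ℕ) :
    j * β (sinHarmonic ℓ j) (cosHarmonic ℓ' j') + j' * β (cosHarmonic ℓ j) (sinHarmonic ℓ' j') = 0 := by
  have h := hβ.rotZ _ _ _ _ (isGenerator_rotZ_cosHarmonic ℓ j) (isGenerator_rotZ_cosHarmonic ℓ' j')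
  simp only [map_smul, LinearMap.smul_apply, smul_eq_mul] at h
  linear_combination -h

lemma rotZ_cos_sin (hβ : IsInvariantForm β) (ℓ j ℓ' j' : ℕ) :
    j * β (sinHarmonic ℓ j) (sinHarmonic ℓ' j') = j' * β (cosHarmonic ℓ j) (cosHarmonic ℓ' j') := by
  have h := hβ.rotZ _ _ _ _ (isGenerator_rotZ_cosHarmonic ℓ j) (isGenerator_rotZ_sinHarmonic ℓ' j')
  simp only [map_smul, LinearMap.smul_apply, smul_eq_mul] at h
  linear_combination -h

lemma rotZ_sin_cos (hβ : IsInvariantForm β) (ℓ j ℓ' j' : ℕ) :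
    j * β (cosHarmonic ℓ j) (cosHarmonic ℓ' j') = j' * β (sinHarmonic ℓ j) (sinHarmonic ℓ' j') := by
  have h := hβ.rotZ _ _ _ _ (isGenerator_rotZ_sinHarmonic ℓ j) (isGenerator_rotZ_cosHarmonic ℓ' j')
  simp only [map_smul, LinearMap.smul_apply, smul_eq_mul] at h
  linear_combination h

lemma rotZ_sin_sin (hβ : IsInvariantForm β) (ℓ j ℓ' j' : ℕ) :
    j * β (cosHarmonic ℓ j) (sinHarmonic ℓ' j') + j' * β (sinHarmonic ℓ j) (cosHarmonic ℓ' j') = 0 := by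
  have h := hβ.rotZ _ _ _ _ (isGenerator_rotZ_sinHarmonic ℓ j) (isGenerator_rotZ_sinHarmonic ℓ' j')
  simp only [map_smul, LinearMap.smul_apply, smul_eq_mul] at h
  linear_combination h

lemma sq_sub_sq_ne_zero {j j' : ℕ} (h : j ≠ j') : (j : ℝ) ^ 2 - (j' : ℝ) ^ 2 ≠ 0 := by
  rw [sub_ne_zero, Ne, sq_eq_sq₀ (by positivity) (by positivity)]
  exact_mod_cast h

/-- Two rotations about the third axis' worth of relations, $j\,\beta(\cos,\cos)=j'\beta(\sin,\sin)$
and $j\,\beta(\sin,\sin)=j'\beta(\cos,\cos)$, combine to $(j^2-j'^2)\,\beta(\cos,\cos)=0$. The next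
two lemmas work in the same way. -/
lemma cos_cos_of_ne (hβ : IsInvariantForm β) (ℓ ℓ' : ℕ) {j j' : ℕ} (h : j ≠ j') :
    β (cosHarmonic ℓ j) (cosHarmonic ℓ' j') = 0 := by
  refine (mul_eq_zero.1 ?_).resolve_left (sq_sub_sq_ne_zero h)
  linear_combination j * hβ.rotZ_sin_cos ℓ j ℓ' j' + j' * hβ.rotZ_cos_sin ℓ j ℓ' j'

lemma sin_sin_of_ne (hβ : IsInvariantForm β) (ℓ ℓ' : ℕ) {j j' : ℕ} (h : j ≠ j') :
    β (sinHarmonic ℓ j) (sinHarmonic ℓ' j') = 0 := by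
  refine (mul_eq_zero.1 ?_).resolve_left (sq_sub_sq_ne_zero h)
  linear_combination j' * hβ.rotZ_sin_cos ℓ j ℓ' j' + j * hβ.rotZ_cos_sin ℓ j ℓ' j'

lemma cos_sin_of_ne (hβ : IsInvariantForm β) (ℓ ℓ' : ℕ) {j j' : ℕ} (h : j ≠ j') :
    β (cosHarmonic ℓ j) (sinHarmonic ℓ' j') = 0 := by
  refine (mul_eq_zero.1 ?_).resolve_left (sq_sub_sq_ne_zero h)
  linear_combination j * hβ.rotZ_sin_sin ℓ j ℓ' j' - j' * hβ.rotZ_cos_cos ℓ j ℓ' j'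

/-- For equal orders `rotZ` gives no such conclusion. The `rotY` relation applied to the orders $j$
and $j+1$ loses its terms of unequal order and expresses the value at $j+1$ through that at $j$; the
descent ends at the vanishing sine of order zero. -/
lemma cos_sin_self (hβ : IsInvariantForm β) (ℓ ℓ' j : ℕ) :
    β (cosHarmonic ℓ j) (sinHarmonic ℓ' j) = 0 := by
  induction j with
  | zero => rw [sinHarmonic_zero_right, map_zero]
  | succ j ih =>
    rcases j with _ | i
    · have h := hβ.rotY _ _ _ _ (isGenerator_rotY_cosHarmonic_zero ℓ)
        (isGenerator_rotY_sinHarmonic_succ ℓ' 0)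
      simp only [map_smul, map_neg, map_sub, LinearMap.neg_apply, smul_eq_mul, ih,
        hβ.cos_sin_of_ne ℓ ℓ' (show 0 ≠ 0 + 2 by omega)] at h
      linear_combination -h
    · have h := hβ.rotY _ _ _ _ (isGenerator_rotY_cosHarmonic_succ ℓ i)
        (isGenerator_rotY_sinHarmonic_succ ℓ' (i + 1))
      simp only [map_smul, map_sub, LinearMap.smul_apply, LinearMap.sub_apply, smul_eq_mul, ih,
        hβ.cos_sin_of_ne ℓ ℓ' (show i + 1 ≠ i + 1 + 2 by omega),
        hβ.cos_sin_of_ne ℓ ℓ' (show i ≠ i + 1 + 1 by omega)] at h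
      linear_combination -2 * h

lemma cos_sin (hβ : IsInvariantForm β) (ℓ ℓ' j j' : ℕ) :
    β (cosHarmonic ℓ j) (sinHarmonic ℓ' j') = 0 := by
  rcases eq_or_ne j j' with rfl | h
  · exact hβ.cos_sin_self ℓ ℓ' j
  · exact hβ.cos_sin_of_ne ℓ ℓ' h

lemma cos_cos_one (hβ : IsInvariantForm β) (ℓ ℓ' : ℕ) :
    β (cosHarmonic ℓ 1) (cosHarmonic ℓ' 1) =
      ladderCoeff ℓ' 0 / 2 * β (cosHarmonic ℓ 0) (cosHarmonic ℓ' 0) := by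
  have h := hβ.rotY _ _ _ _ (isGenerator_rotY_cosHarmonic_zero ℓ)
    (isGenerator_rotY_cosHarmonic_succ ℓ' 0)
  simp only [map_smul, map_neg, map_sub, LinearMap.neg_apply, smul_eq_mul,
    hβ.cos_cos_of_ne ℓ ℓ' (show 0 ≠ 0 + 2 by omega), zero_add] at h
  linear_combination -h

lemma cos_cos_succ (hβ : IsInvariantForm β) (ℓ ℓ' i : ℕ) :
    β (cosHarmonic ℓ (i + 2)) (cosHarmonic ℓ' (i + 2)) =
      ladderCoeff ℓ' (i + 1) * β (cosHarmonic ℓ (i + 1)) (cosHarmonic ℓ' (i + 1)) := by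
  have h := hβ.rotY _ _ _ _ (isGenerator_rotY_cosHarmonic_succ ℓ i)
    (isGenerator_rotY_cosHarmonic_succ ℓ' (i + 1))
  simp only [map_smul, map_sub, LinearMap.smul_apply, LinearMap.sub_apply, smul_eq_mul,
    hβ.cos_cos_of_ne ℓ ℓ' (show i + 1 ≠ i + 1 + 2 by omega),
    hβ.cos_cos_of_ne ℓ ℓ' (show i ≠ i + 1 + 1 by omega)] at h
  linear_combination -2 * h

lemma ladderCoeff_zero_injective : Function.Injective fun ℓ => ladderCoeff ℓ 0 := by
  intro a b h
  simp only [ladderCoeff, Nat.cast_zero, add_zero, sub_zero] at h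
  have h' : (a + 1) * a = (b + 1) * b := by exact_mod_cast h
  nlinarith

/-- The ladder constant in `cos_cos_one` is that of the second argument, $\ell'(\ell'+1)$.
Exchanging the arguments by symmetry gives the same identity with $\ell(\ell+1)$, so the order-zero
value vanishes. This is orthogonality of eigenspaces with distinct eigenvalues; the ladder carries
it to higher orders. -/
lemma cos_cos_of_degree_ne (hβ : IsInvariantForm β) {ℓ ℓ' : ℕ} (h : ℓ ≠ ℓ') (j : ℕ) :
    β (cosHarmonic ℓ j) (cosHarmonic ℓ' j) = 0 := by
  have h0 : β (cosHarmonic ℓ 0) (cosHarmonic ℓ' 0) = 0 := by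
    have h1 := hβ.cos_cos_one ℓ ℓ'
    have h2 := hβ.cos_cos_one ℓ' ℓ
    rw [hβ.symm (cosHarmonic ℓ' 1), hβ.symm (cosHarmonic ℓ' 0), h1] at h2
    refine (mul_eq_zero.1 ?_).resolve_left (sub_ne_zero.2 (ladderCoeff_zero_injective.ne h))
    linear_combination -2 * h2
  induction j with
  | zero => exact h0
  | succ j ih =>
    rcases j with _ | i
    · rw [zero_add, hβ.cos_cos_one, h0, mul_zero]
    · rw [hβ.cos_cos_succ, ih, mul_zero]

lemma sin_sin_self (hβ : IsInvariantForm β) (ℓ ℓ' : ℕ) {j : ℕ} (hj : j ≠ 0) :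
    β (sinHarmonic ℓ j) (sinHarmonic ℓ' j) = β (cosHarmonic ℓ j) (cosHarmonic ℓ' j) :=
  mul_left_cancel₀ (Nat.cast_ne_zero.2 hj) (hβ.rotZ_cos_sin ℓ j ℓ' j)

/-- The product of the ladder constants $(\ell+j+1)(\ell-j)$ over $j\le i$ is
$(\ell+i+1)!/(\ell-i-1)!$, and the step from order zero contributes the factor $\frac12$. The
normalization of $Y_{\ell,m}$ cancels exactly this. -/
lemma cos_cos_self (hβ : IsInvariantForm β) {ℓ i : ℕ} (hi : i + 1 ≤ ℓ) :
    ((ℓ - (i + 1)).factorial : ℝ) * β (cosHarmonic ℓ (i + 1)) (cosHarmonic ℓ (i + 1)) =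
      ((ℓ + (i + 1)).factorial : ℝ) / 2 * β (cosHarmonic ℓ 0) (cosHarmonic ℓ 0) := by
  induction i with
  | zero =>
    obtain ⟨n, rfl⟩ := Nat.exists_eq_add_of_le' hi
    simp only [zero_add, hβ.cos_cos_one, ladderCoeff, Nat.add_sub_cancel]
    rw [Nat.factorial_succ (n + 1), Nat.factorial_succ n]
    push_cast
    ring
  | succ i ih =>
    obtain ⟨n, rfl⟩ := Nat.exists_eq_add_of_le' hi
    have h := ih (by omega)
    rw [show n + (i + 1 + 1) - (i + 1) = n + 1 by omega, Nat.factorial_succ] at h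
    rw [Nat.add_sub_cancel, hβ.cos_cos_succ,
      show n + (i + 1 + 1) + (i + 1 + 1) = (n + (i + 1 + 1) + (i + 1)) + 1 by ring,
      Nat.factorial_succ, ladderCoeff]
    push_cast at h ⊢
    linear_combination (n + (i + 1 + 1) + (i + 1) + 1 : ℝ) * h

end IsInvariantForm

/-! ### The harmonics `Y_{ℓ,m}` diagonalize invariant forms -/

/-- The normalization of `Y_{ℓ,m}` relative to the real and imaginary parts of the complex
harmonics. -/
def realHarmonicConst (ℓ : ℕ) (m : ℤ) : ℝ :=
  if m = 0 then Real.sqrt (2 * ℓ + 1) else Real.sqrt 2 * harmonicConst ℓ m.natAbs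

/-- `Y_{ℓ,m}` without its normalization. -/
def bareHarmonic (ℓ : ℕ) (m : ℤ) : C(S2, ℝ) :=
  if m < 0 then sinHarmonic ℓ m.natAbs else cosHarmonic ℓ m.natAbs

/-- `Y_{ℓ,m}` as a continuous function. -/
def continuousY (ℓ : ℕ) (m : ℤ) : C(S2, ℝ) := realHarmonicConst ℓ m • bareHarmonic ℓ m

lemma continuousY_apply (ℓ : ℕ) (m : ℤ) (x : S2) : continuousY ℓ m x = Y ℓ m x := by
  have hp : ∀ j, complexHarmonic ℓ j x = (((Polynomial.derivative^[j] (legendre ℓ)).eval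
    ((x : E3) 2) : ℝ) : ℂ) * (⟨(x : E3) 0, (x : E3) 1⟩ : ℂ) ^ j := fun j => rfl
  rw [continuousY, ContinuousMap.smul_apply, bareHarmonic, realHarmonicConst, Y, smul_eq_mul]
  rcases lt_trichotomy m 0 with h | h | h
  · rw [if_neg h.ne, if_pos h]
    simp only [if_pos h]
    rw [sinHarmonic_apply, hp, Complex.im_ofReal_mul]
    ring
  · subst h
    simp [cosHarmonic_apply, hp]
  · rw [if_neg h.ne', if_neg h.not_gt]
    simp only [if_neg h.not_gt, if_neg h.ne']
    rw [cosHarmonic_apply, hp, Complex.re_ofReal_mul]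
    ring

lemma continuous_Y (ℓ : ℕ) (m : ℤ) : Continuous (Y ℓ m) := by
  have h : Y ℓ m = continuousY ℓ m := funext fun x => (continuousY_apply ℓ m x).symm
  rw [h]
  exact (continuousY ℓ m).continuous

lemma realHarmonicConst_sq_zero (ℓ : ℕ) : realHarmonicConst ℓ 0 ^ 2 = 2 * ℓ + 1 := by
  rw [realHarmonicConst, if_pos rfl, Real.sq_sqrt (by positivity)]

lemma realHarmonicConst_sq (ℓ : ℕ) {m : ℤ} (hm : m ≠ 0) : realHarmonicConst ℓ m ^ 2 =
    2 * ((2 * ℓ + 1) * ((ℓ - m.natAbs).factorial : ℝ) / ((ℓ + m.natAbs).factorial : ℝ)) := by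
  rw [realHarmonicConst, if_neg hm, harmonicConst, mul_pow, mul_pow, ← pow_mul, mul_comm m.natAbs,
    pow_mul, neg_one_sq, one_pow, one_mul, Real.sq_sqrt (by norm_num), Real.sq_sqrt (by positivity)]

lemma natAbs_le_of_mem_orders {ℓ : ℕ} {m : ℤ} (hm : m ∈ orders ℓ) : m.natAbs ≤ ℓ := by
  rw [orders, Finset.mem_Icc] at hm
  omega

namespace IsInvariantForm

variable {β : C(S2, ℝ) →ₗ[ℝ] C(S2, ℝ) →ₗ[ℝ] ℝ}

lemma bare_bare_of_ne (hβ : IsInvariantForm β) {ℓ ℓ' : ℕ} {m m' : ℤ} (h : ¬(ℓ = ℓ' ∧ m = m')) :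
    β (bareHarmonic ℓ m) (bareHarmonic ℓ' m') = 0 := by
  unfold bareHarmonic
  split_ifs with h1 h2 h2
  · rcases eq_or_ne m.natAbs m'.natAbs with hm | hm
    · rw [← hm, hβ.sin_sin_self _ _ (by omega)]
      exact hβ.cos_cos_of_degree_ne (by omega) _
    · exact hβ.sin_sin_of_ne _ _ hm
  · rw [hβ.symm, hβ.cos_sin]
  · exact hβ.cos_sin _ _ _ _
  · rcases eq_or_ne m.natAbs m'.natAbs with hm | hm
    · rw [← hm]
      exact hβ.cos_cos_of_degree_ne (by omega) _
    · exact hβ.cos_cos_of_ne _ _ hm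

lemma Y_Y_self (hβ : IsInvariantForm β) {ℓ : ℕ} {m : ℤ} (hm : m ∈ orders ℓ) :
    β (continuousY ℓ m) (continuousY ℓ m) =
      (2 * ℓ + 1) * β (cosHarmonic ℓ 0) (cosHarmonic ℓ 0) := by
  rw [continuousY, map_smul, map_smul, LinearMap.smul_apply, smul_eq_mul, smul_eq_mul, ← mul_assoc,
    ← sq]
  rcases eq_or_ne m 0 with rfl | h0
  · rw [realHarmonicConst_sq_zero]
    simp [bareHarmonic]
  · have hb : β (bareHarmonic ℓ m) (bareHarmonic ℓ m) =
        β (cosHarmonic ℓ m.natAbs) (cosHarmonic ℓ m.natAbs) := by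
      unfold bareHarmonic
      split_ifs
      · exact hβ.sin_sin_self _ _ (by omega)
      · rfl
    rw [hb, realHarmonicConst_sq ℓ h0]
    obtain ⟨i, hi⟩ := Nat.exists_eq_succ_of_ne_zero (Int.natAbs_ne_zero.2 h0)
    have hle := natAbs_le_of_mem_orders hm
    rw [hi] at hle ⊢
    have h := hβ.cos_cos_self hle
    have hf : ((ℓ + i.succ).factorial : ℝ) ≠ 0 := by positivity
    simp only [Nat.succ_eq_add_one] at h hf ⊢
    field_simp
    linear_combination 2 * h

/-- Schur orthogonality: the spherical harmonics diagonalize every invariant form, with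
eigenvalues that depend on the degree only. -/
theorem Y_Y (hβ : IsInvariantForm β) {ℓ ℓ' : ℕ} {m m' : ℤ} (hm : m ∈ orders ℓ) :
    β (continuousY ℓ m) (continuousY ℓ' m') =
      if ℓ = ℓ' ∧ m = m' then (2 * ℓ + 1) * β (cosHarmonic ℓ 0) (cosHarmonic ℓ 0) else 0 := by
  split_ifs with h
  · obtain ⟨rfl, rfl⟩ := h
    exact hβ.Y_Y_self hm
  · rw [continuousY, continuousY, map_smul, map_smul, LinearMap.smul_apply, hβ.bare_bare_of_ne h,
      smul_zero, smul_zero]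

end IsInvariantForm

/-! ### The addition theorem -/

/-- The reproducing kernel `∑ₘ Y_{ℓ,m}(x) Y_{ℓ,m}(y)` of the harmonics of degree `ℓ`. -/
def zonalKernel (ℓ : ℕ) (x y : S2) : ℝ := ∑ m ∈ orders ℓ, Y ℓ m x * Y ℓ m y

lemma sum_orders (f : ℤ → ℝ) (ℓ : ℕ) :
    ∑ m ∈ orders ℓ, f m = f 0 + ∑ i ∈ Finset.range ℓ, (f (i + 1) + f (-(i + 1))) := by
  induction ℓ with
  | zero => simp [orders]
  | succ n ih =>
    have h : orders (n + 1) = insert ((n : ℤ) + 1) (insert (-((n : ℤ) + 1)) (orders n)) := by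
      ext m
      simp only [orders, Finset.mem_insert, Finset.mem_Icc]
      push_cast
      omega
    rw [h, Finset.sum_insert (by simp [orders]; omega), Finset.sum_insert (by simp [orders]), ih,
      Finset.sum_range_succ]
    ring

lemma card_orders (ℓ : ℕ) : ((orders ℓ).card : ℝ) = 2 * ℓ + 1 := by
  have : (orders ℓ).card = 2 * ℓ + 1 := by
    simp only [orders, Int.card_Icc]
    omega
  rw [this]; push_cast; rfl

/-- The weight `(ℓ-j)!/(ℓ+j)!`. -/
def ladderWeight (ℓ j : ℕ) : ℝ := ((ℓ - j).factorial : ℝ) / ((ℓ + j).factorial : ℝ)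

lemma ladderWeight_zero (ℓ : ℕ) : ladderWeight ℓ 0 = 1 := by
  rw [ladderWeight, Nat.sub_zero, Nat.add_zero, div_self (by positivity)]

/-- This identity makes the derivative of the reproducing kernel along `rotY` telescope. -/
lemma ladderWeight_succ {ℓ i : ℕ} (hi : i < ℓ) :
    ladderWeight ℓ (i + 1) * ladderCoeff ℓ i = ladderWeight ℓ i := by
  obtain ⟨n, rfl⟩ := Nat.exists_eq_add_of_le' (Nat.succ_le_of_lt hi)
  rw [ladderWeight, ladderWeight, ladderCoeff, Nat.succ_eq_add_one, Nat.add_sub_cancel,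
    show n + (i + 1) - i = n + 1 by omega, ← add_assoc (n + (i + 1)), Nat.factorial_succ n,
    Nat.factorial_succ (n + (i + 1) + i)]
  push_cast
  field_simp
  ring

lemma zonalKernel_eq (ℓ : ℕ) (x y : S2) : zonalKernel ℓ x y = (2 * ℓ + 1) *
    (cosHarmonic ℓ 0 x * cosHarmonic ℓ 0 y + ∑ i ∈ Finset.range ℓ, 2 * ladderWeight ℓ (i + 1) *
      (cosHarmonic ℓ (i + 1) x * cosHarmonic ℓ (i + 1) y +
        sinHarmonic ℓ (i + 1) x * sinHarmonic ℓ (i + 1) y)) := by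
  have hY : ∀ m, Y ℓ m x * Y ℓ m y =
      realHarmonicConst ℓ m ^ 2 * (bareHarmonic ℓ m x * bareHarmonic ℓ m y) := by
    intro m
    rw [← continuousY_apply, ← continuousY_apply]
    simp only [continuousY, ContinuousMap.smul_apply, smul_eq_mul]
    ring
  simp only [zonalKernel, hY]
  rw [sum_orders, realHarmonicConst_sq_zero, mul_add, Finset.mul_sum]
  congr 1
  refine Finset.sum_congr rfl fun i _ => ?_
  have h1 : ((i : ℤ) + 1).natAbs = i + 1 := by omega
  have h2 : (-((i : ℤ) + 1)).natAbs = i + 1 := by omega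
  rw [realHarmonicConst_sq ℓ (by omega), realHarmonicConst_sq ℓ (by omega), bareHarmonic,
    bareHarmonic, if_neg (by omega), if_pos (by omega), h1, h2, ladderWeight]
  ring

lemma hasDerivAt_zonalKernel_rotZ (ℓ : ℕ) (x y : S2) (θ : ℝ) :
    HasDerivAt (fun θ => zonalKernel ℓ (rotate (rotZ θ) x) (rotate (rotZ θ) y)) 0 θ := by
  simp_rw [zonalKernel_eq]
  have hc := fun j (x : S2) => isGenerator_rotZ_cosHarmonic ℓ j x θ
  have hs := fun j (x : S2) => isGenerator_rotZ_sinHarmonic ℓ j x θ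
  have h := (((hc 0 x).mul (hc 0 y)).add (HasDerivAt.fun_sum (u := Finset.range ℓ) fun i _ =>
    (((hc (i + 1) x).mul (hc (i + 1) y)).add ((hs (i + 1) x).mul (hs (i + 1) y))).const_mul
      (2 * ladderWeight ℓ (i + 1)))).const_mul (2 * ℓ + 1 : ℝ)
  convert! h using 1
  simp only [ContinuousMap.smul_apply, smul_eq_mul]
  rw [Finset.sum_eq_zero (fun i _ => by ring)]
  simp

/-- The derivatives of the summands are differences $S_i-S_{i+1}$ of cross terms between
neighbouring orders. $S_0$ cancels the contribution of order zero, and $S_\ell$ vanishes because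
$P_\ell^{(\ell+1)}=0$. -/
lemma hasDerivAt_zonalKernel_rotY (ℓ : ℕ) (x y : S2) (θ : ℝ) :
    HasDerivAt (fun θ => zonalKernel ℓ (rotate (rotY θ) x) (rotate (rotY θ) y)) 0 θ := by
  simp_rw [zonalKernel_eq]
  have h0 := fun (x : S2) => isGenerator_rotY_cosHarmonic_zero ℓ x θ
  have hc := fun j (x : S2) => isGenerator_rotY_cosHarmonic_succ ℓ j x θ
  have hs := fun j (x : S2) => isGenerator_rotY_sinHarmonic_succ ℓ j x θ
  have h := (((h0 x).mul (h0 y)).add (HasDerivAt.fun_sum (u := Finset.range ℓ) fun i _ =>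
    (((hc i x).mul (hc i y)).add ((hs i x).mul (hs i y))).const_mul
      (2 * ladderWeight ℓ (i + 1)))).const_mul (2 * ℓ + 1 : ℝ)
  convert! h using 1
  simp only [ContinuousMap.smul_apply, ContinuousMap.sub_apply, ContinuousMap.neg_apply,
    smul_eq_mul]
  set X := rotate (rotY θ) x
  set Z := rotate (rotY θ) y
  let S : ℕ → ℝ := fun j => ladderWeight ℓ j *
    (cosHarmonic ℓ (j + 1) X * cosHarmonic ℓ j Z + cosHarmonic ℓ j X * cosHarmonic ℓ (j + 1) Z +
      (sinHarmonic ℓ (j + 1) X * sinHarmonic ℓ j Z + sinHarmonic ℓ j X * sinHarmonic ℓ (j + 1) Z))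
  have hS : ∀ i ∈ Finset.range ℓ, 2 * ladderWeight ℓ (i + 1) *
      (1 / 2 * (ladderCoeff ℓ i * cosHarmonic ℓ i X - cosHarmonic ℓ (i + 2) X) *
        cosHarmonic ℓ (i + 1) Z + cosHarmonic ℓ (i + 1) X *
        (1 / 2 * (ladderCoeff ℓ i * cosHarmonic ℓ i Z - cosHarmonic ℓ (i + 2) Z)) +
      (1 / 2 * (ladderCoeff ℓ i * sinHarmonic ℓ i X - sinHarmonic ℓ (i + 2) X) *
        sinHarmonic ℓ (i + 1) Z + sinHarmonic ℓ (i + 1) X *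
        (1 / 2 * (ladderCoeff ℓ i * sinHarmonic ℓ i Z - sinHarmonic ℓ (i + 2) Z)))) =
      S i - S (i + 1) := by
    intro i hi
    simp only [S]
    rw [← ladderWeight_succ (Finset.mem_range.1 hi)]
    ring
  rw [Finset.sum_congr rfl hS, Finset.sum_range_sub']
  simp only [S, ladderWeight_zero, cosHarmonic_of_lt (Nat.lt_succ_self ℓ),
    sinHarmonic_of_lt (Nat.lt_succ_self ℓ), sinHarmonic_zero_right, ContinuousMap.zero_apply]
  ring

lemma eq_of_hasDerivAt_zero {f : ℝ → ℝ} (h : ∀ θ, HasDerivAt f 0 θ) (a b : ℝ) : f a = f b :=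
  is_const_of_deriv_eq_zero (fun θ => (h θ).differentiableAt) (fun θ => (h θ).deriv) a b

lemma rotate_rotY_zero (x : S2) : rotate (rotY 0) x = x := by
  apply Subtype.ext
  ext i
  fin_cases i <;> simp [rotate, rotY_apply]

lemma rotate_rotZ_zero (x : S2) : rotate (rotZ 0) x = x := by
  apply Subtype.ext
  ext i
  fin_cases i <;> simp [rotate, rotZ_apply]

lemma inner_rotate (ρ : E3 ≃ₗᵢ[ℝ] E3) (x y : S2) :
    inner ℝ (rotate ρ x : E3) (rotate ρ y : E3) = inner ℝ (x : E3) (y : E3) :=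
  ρ.inner_map_map _ _

/-- The addition theorem for spherical harmonics. -/
theorem zonalKernel_eq_legendre (ℓ : ℕ) (x y : S2) :
    zonalKernel ℓ x y = (2 * ℓ + 1) * (legendre ℓ).eval (inner ℝ (x : E3) (y : E3)) := by
  -- The kernel is constant along both flows, so $x$ may be moved to the north pole, where the
  -- planar part is zero and only the term of order zero survives.
  obtain ⟨θ, φ, hx⟩ := exists_rotate_eq_northPole x
  have h1 := eq_of_hasDerivAt_zero (hasDerivAt_zonalKernel_rotZ ℓ x y) 0 φ
  have h2 := eq_of_hasDerivAt_zero
    (hasDerivAt_zonalKernel_rotY ℓ (rotate (rotZ φ) x) (rotate (rotZ φ) y)) 0 θ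
  simp only [rotate_rotY_zero, rotate_rotZ_zero] at h1 h2
  rw [h1, h2, ← inner_rotate (rotZ φ) x y, ← inner_rotate (rotY θ), hx, zonalKernel_eq,
    cosHarmonic_zero_right, cosHarmonic_zero_right, height_northPole, eval_legendre_one,
    Finset.sum_eq_zero]
  · rw [one_mul, add_zero]
    congr 2
    simp [northPole, height, PiLp.inner_apply, Fin.sum_univ_three]
  · intro i _
    simp [cosHarmonic_apply, sinHarmonic_apply, complexHarmonic, planar_northPole]

lemma zonalKernel_rotate (ρ : E3 ≃ₗᵢ[ℝ] E3) (ℓ : ℕ) (x y : S2) :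
    zonalKernel ℓ (rotate ρ x) (rotate ρ y) = zonalKernel ℓ x y := by
  rw [zonalKernel_eq_legendre, zonalKernel_eq_legendre, inner_rotate]

lemma zonalKernel_self (ℓ : ℕ) (x : S2) : zonalKernel ℓ x x = 2 * ℓ + 1 := by
  rw [zonalKernel_eq_legendre, real_inner_self_eq_norm_sq, norm_eq_of_mem_sphere, one_pow,
    eval_legendre_one, mul_one]

/-! ### Rotation invariance of the surface measure -/

instance : IsProbabilityMeasure sphereMeasure := by
  refine ⟨?_⟩
  rw [sphereMeasure, Measure.smul_apply, smul_eq_mul]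
  refine ENNReal.inv_mul_cancel ?_ (measure_ne_top _ _)
  rw [Ne, Measure.measure_univ_eq_zero]
  exact Measure.toSphere_ne_zero volume

/-- A linear isometry as a measurable equivalence of the sphere. -/
def rotateEquiv (ρ : E3 ≃ₗᵢ[ℝ] E3) : S2 ≃ᵐ S2 where
  toFun := rotate ρ
  invFun := rotate ρ.symm
  left_inv x := Subtype.ext (ρ.symm_apply_apply _)
  right_inv x := Subtype.ext (ρ.apply_symm_apply _)
  measurable_toFun := (Continuous.subtype_mk (by fun_prop) _ : Continuous (rotate ρ)).measurable
  measurable_invFun :=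
    (Continuous.subtype_mk (by fun_prop) _ : Continuous (rotate ρ.symm)).measurable

lemma continuous_rotate (ρ : E3 ≃ₗᵢ[ℝ] E3) : Continuous (rotate ρ) :=
  Continuous.subtype_mk (by fun_prop) _

open scoped Pointwise in
lemma measurePreserving_rotateEquiv (ρ : E3 ≃ₗᵢ[ℝ] E3) :
    MeasurePreserving (rotateEquiv ρ) sphereMeasure sphereMeasure := by
  have h : MeasurePreserving (rotateEquiv ρ) (volume : Measure E3).toSphere
      (volume : Measure E3).toSphere := by
    refine ⟨(rotateEquiv ρ).measurable, Measure.ext fun s hs => ?_⟩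
    rw [Measure.map_apply (rotateEquiv ρ).measurable hs, Measure.toSphere_apply' _ hs,
      Measure.toSphere_apply' _ ((rotateEquiv ρ).measurable hs)]
    congr 1
    have e : (Set.Ioo (0 : ℝ) 1 • ((↑) '' (rotateEquiv ρ ⁻¹' s) : Set E3)) =
        ρ ⁻¹' (Set.Ioo (0 : ℝ) 1 • ((↑) '' s : Set E3)) := by
      ext v
      simp only [Set.mem_smul, Set.mem_image, Set.mem_preimage]
      constructor
      · rintro ⟨r, hr, _, ⟨x, hx, rfl⟩, rfl⟩
        exact ⟨r, hr, _, ⟨rotateEquiv ρ x, hx, rfl⟩, (ρ.map_smul r (x : E3)).symm⟩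
      · rintro ⟨r, hr, _, ⟨x, hx, rfl⟩, h⟩
        refine ⟨r, hr, _, ⟨(rotateEquiv ρ).symm x, by simpa using hx, rfl⟩, ?_⟩
        apply ρ.injective
        rw [← h, map_smul]
        congr 1
        exact ρ.apply_symm_apply _
    rw [e]
    exact ρ.measurePreserving.measure_preimage_emb ρ.toHomeomorph.measurableEmbedding _
  exact h.smul_measure _

/-! ### Integral forms -/

section IntegralForm

variable {T : Type*} [MeasurableSpace T] {τ : Measure T} {r : T → ℝ} {a b : T → S2}

lemma integrable_weight_mul (hr : Integrable r τ) (ha : Measurable a) (hb : Measurable b)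
    (f g : C(S2, ℝ)) : Integrable (fun t => r t * (f (a t) * g (b t))) τ := by
  refine hr.mul_bdd (c := ‖f‖ * ‖g‖) ?_ (ae_of_all _ fun t => ?_)
  · exact ((f.continuous.measurable.comp ha).mul (g.continuous.measurable.comp hb)).aestronglyMeasurable
  · rw [norm_mul]
    exact mul_le_mul (f.norm_coe_le_norm _) (g.norm_coe_le_norm _) (norm_nonneg _) (norm_nonneg _)

/-- The bilinear form `∫ r(t) f(a(t)) g(b(t)) dτ(t)`. -/
def integralForm (hr : Integrable r τ) (ha : Measurable a) (hb : Measurable b) :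
    C(S2, ℝ) →ₗ[ℝ] C(S2, ℝ) →ₗ[ℝ] ℝ :=
  LinearMap.mk₂ ℝ (fun f g => ∫ t, r t * (f (a t) * g (b t)) ∂τ)
    (fun f f' g => by
      rw [← integral_add (integrable_weight_mul hr ha hb f g) (integrable_weight_mul hr ha hb f' g)]
      congr 1; funext t; simp; ring)
    (fun c f g => by
      rw [← integral_smul]
      congr 1; funext t; simp; ring)
    (fun f g g' => by
      rw [← integral_add (integrable_weight_mul hr ha hb f g) (integrable_weight_mul hr ha hb f g')]
      congr 1; funext t; simp; ring)
    (fun c f g => by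
      rw [← integral_smul]
      congr 1; funext t; simp; ring)

lemma integralForm_apply (hr : Integrable r τ) (ha : Measurable a) (hb : Measurable b)
    (f g : C(S2, ℝ)) : integralForm hr ha hb f g = ∫ t, r t * (f (a t) * g (b t)) ∂τ := rfl

/-- The integral is constant along the flow; its derivative at $\theta=0$, taken under the integral
sign, is the claimed sum. Domination is immediate since $f,f',g,g'$ are bounded on the compact
sphere. -/
lemma integralForm_generator (hr : Integrable r τ) (ha : Measurable a) (hb : Measurable b)
    {ρ : ℝ → E3 ≃ₗᵢ[ℝ] E3} (hρ0 : ∀ x, rotate (ρ 0) x = x)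
    (hinv : ∀ θ, ∀ f g : C(S2, ℝ), ∫ t, r t * (f (rotate (ρ θ) (a t)) * g (rotate (ρ θ) (b t))) ∂τ =
      ∫ t, r t * (f (a t) * g (b t)) ∂τ)
    {f f' g g' : C(S2, ℝ)} (hf : IsGenerator ρ f f') (hg : IsGenerator ρ g g') :
    integralForm hr ha hb f' g + integralForm hr ha hb f g' = 0 := by
  have hm : ∀ θ, Measurable fun t => rotate (ρ θ) (a t) := fun θ =>
    (continuous_rotate _).measurable.comp ha
  have hm' : ∀ θ, Measurable fun t => rotate (ρ θ) (b t) := fun θ =>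
    (continuous_rotate _).measurable.comp hb
  have h := hasDerivAt_integral_of_dominated_loc_of_deriv_le (μ := τ) (x₀ := (0 : ℝ))
    (s := Set.univ) (bound := fun t => ‖r t‖ * (‖f'‖ * ‖g‖ + ‖f‖ * ‖g'‖))
    (F := fun θ t => r t * (f (rotate (ρ θ) (a t)) * g (rotate (ρ θ) (b t))))
    (F' := fun θ t => r t * (f' (rotate (ρ θ) (a t)) * g (rotate (ρ θ) (b t)) +
      f (rotate (ρ θ) (a t)) * g' (rotate (ρ θ) (b t))))
    Filter.univ_mem
    (Eventually.of_forall fun θ => (integrable_weight_mul hr (hm θ) (hm' θ) f g).1)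
    (integrable_weight_mul hr (hm 0) (hm' 0) f g)
    (by
      have := ((integrable_weight_mul hr (hm 0) (hm' 0) f' g).add
        (integrable_weight_mul hr (hm 0) (hm' 0) f g')).1
      refine this.congr (ae_of_all _ fun t => ?_)
      simp only [Pi.add_apply]
      ring)
    (ae_of_all _ fun t θ _ => by
      rw [norm_mul]
      refine mul_le_mul_of_nonneg_left ((norm_add_le _ _).trans ?_) (norm_nonneg _)
      rw [norm_mul, norm_mul]
      gcongr <;> exact ContinuousMap.norm_coe_le_norm _ _)
    (hr.norm.mul_const _)
    (ae_of_all _ fun t θ _ => ((hf (a t) θ).mul (hg (b t) θ)).const_mul _)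
  have h2 := h.2
  simp only [hinv] at h2
  have h3 := h2.unique (hasDerivAt_const (0 : ℝ) (∫ t, r t * (f (a t) * g (b t)) ∂τ))
  rw [integralForm_apply, integralForm_apply, ← integral_add (integrable_weight_mul hr ha hb f' g)
    (integrable_weight_mul hr ha hb f g')]
  simp only [hρ0] at h3
  rw [← h3]
  congr 1
  funext t
  ring

lemma isInvariantForm_integralForm (hr : Integrable r τ) (ha : Measurable a) (hb : Measurable b)
    (hsymm : ∀ f g : C(S2, ℝ), ∫ t, r t * (f (a t) * g (b t)) ∂τ =
      ∫ t, r t * (g (a t) * f (b t)) ∂τ)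
    (hinv : ∀ ρ, IsRotation ρ → ∀ f g : C(S2, ℝ),
      ∫ t, r t * (f (rotate ρ (a t)) * g (rotate ρ (b t))) ∂τ =
        ∫ t, r t * (f (a t) * g (b t)) ∂τ) :
    IsInvariantForm (integralForm hr ha hb) where
  symm := hsymm
  rotZ _ _ _ _ hf hg := integralForm_generator hr ha hb rotate_rotZ_zero
    (fun θ => hinv _ (isRotation_rotZ θ)) hf hg
  rotY _ _ _ _ hf hg := integralForm_generator hr ha hb rotate_rotY_zero
    (fun θ => hinv _ (isRotation_rotY θ)) hf hg

end IntegralForm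

/-! ### Orthonormality of the spherical harmonics -/

lemma integral_Y_mul_Y_eq_ite {ℓ ℓ' : ℕ} {m m' : ℤ} (hm : m ∈ orders ℓ) :
    ∫ x, Y ℓ m x * Y ℓ' m' x ∂sphereMeasure = if ℓ = ℓ' ∧ m = m' then 1 else 0 := by
  have hβ : IsInvariantForm (integralForm (τ := sphereMeasure) (r := fun _ => (1 : ℝ))
      (integrable_const 1) measurable_id measurable_id) := by
    refine isInvariantForm_integralForm _ _ _ (fun f g => ?_) (fun ρ _ f g => ?_)
    · simp only [mul_comm]
    · exact (measurePreserving_rotateEquiv ρ).integral_comp' (fun x => 1 * (f x * g x))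
  set β := integralForm (τ := sphereMeasure) (r := fun _ => (1 : ℝ))
      (integrable_const 1) measurable_id measurable_id
  have hY : ∀ ℓ ℓ' m m', ∫ x, Y ℓ m x * Y ℓ' m' x ∂sphereMeasure =
      β (continuousY ℓ m) (continuousY ℓ' m') := by
    intro ℓ ℓ' m m'
    rw [integralForm_apply]
    simp only [continuousY_apply, one_mul, id]
  have hint : ∀ m, Integrable (fun x => Y ℓ m x * Y ℓ m x) sphereMeasure := fun m =>
    ((continuous_Y ℓ m).mul (continuous_Y ℓ m)).integrable_of_hasCompactSupport
      (HasCompactSupport.of_compactSpace _)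
  -- The common value of the norms follows from the trace: the kernel equals $2\ell+1$ on the
  -- diagonal, and the measure has mass one. No Legendre integral has to be computed.
  have hsum : ∑ m ∈ orders ℓ, ∫ x, Y ℓ m x * Y ℓ m x ∂sphereMeasure = 2 * ℓ + 1 := by
    rw [← integral_finsetSum _ fun m _ => hint m]
    have := fun x => zonalKernel_self ℓ x
    simp only [zonalKernel] at this
    simp [this]
  have hone : (2 * ℓ + 1) * β (cosHarmonic ℓ 0) (cosHarmonic ℓ 0) = 1 := by
    rw [Finset.sum_congr rfl fun m hm => (hY ℓ ℓ m m).trans (hβ.Y_Y_self hm), Finset.sum_const,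
      nsmul_eq_mul, card_orders] at hsum
    exact mul_left_cancel₀ (by positivity : (2 * ℓ + 1 : ℝ) ≠ 0) (hsum.trans (mul_one _).symm)
  rw [hY, hβ.Y_Y hm, hone]

/-! ### Second-order structure of an isotropic field -/

/-- The integral of a field against a continuous function. -/
def pairing {Ω : Type*} (ξ : Ω → S2 → ℝ) (f : C(S2, ℝ)) (ω : Ω) : ℝ := ∫ x, ξ ω x * f x ∂sphereMeasure

lemma coeff_eq_pairing {Ω : Type*} (ξ : Ω → S2 → ℝ) (ℓ : ℕ) (m : ℤ) :
    coeff ξ ℓ m = pairing ξ (continuousY ℓ m) := by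
  funext ω
  simp only [coeff, pairing, continuousY_apply]

lemma pairing_mul_pairing {Ω : Type*} (ξ : Ω → S2 → ℝ) (f g : C(S2, ℝ)) (ω : Ω) :
    pairing ξ f ω * pairing ξ g ω =
      ∫ p, ξ ω p.1 * ξ ω p.2 * (f p.1 * g p.2) ∂(sphereMeasure.prod sphereMeasure) := by
  rw [pairing, pairing, ← integral_prod_mul]
  congr 1
  funext p
  ring

section SecondOrder

variable {Ω : Type*} [MeasurableSpace Ω] {P : Measure Ω} {ξ : Ω → S2 → ℝ}

/-- The covariance function of a field. -/
def covariance (P : Measure Ω) (ξ : Ω → S2 → ℝ) (p : S2 × S2) : ℝ := ∫ ω, ξ ω p.1 * ξ ω p.2 ∂P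

lemma IsTwoWeaklyIsotropic.covariance_rotate (hiso : IsTwoWeaklyIsotropic P ξ)
    {ρ : E3 ≃ₗᵢ[ℝ] E3} (hρ : IsRotation ρ) (x y : S2) :
    covariance P ξ (rotate ρ x, rotate ρ y) = covariance P ξ (x, y) :=
  ((hiso.2 ρ hρ x y).2).symm

/-- Rotations act transitively, so the second moment is the same at every point. This is what makes
the field square integrable on $\Omega\times\mathbb S^2$. -/
lemma IsTwoWeaklyIsotropic.integral_sq (hiso : IsTwoWeaklyIsotropic P ξ) (x : S2) :
    ∫ ω, ξ ω x ^ 2 ∂P = covariance P ξ (northPole, northPole) := by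
  obtain ⟨θ, φ, hx⟩ := exists_rotate_eq_northPole x
  have h1 := hiso.covariance_rotate (isRotation_rotZ φ) x x
  have h2 := hiso.covariance_rotate (isRotation_rotY θ) (rotate (rotZ φ) x) (rotate (rotZ φ) x)
  rw [hx, h1] at h2
  rw [h2, covariance]
  simp only [sq]

lemma integrable_mul_continuous
    (h : MemLp (fun p : Ω × S2 => ξ p.1 p.2) 2 (P.prod sphereMeasure)) (f : C(S2, ℝ)) {η : Ω → ℝ}
    (hη : MemLp η 2 P) :
    Integrable (fun p : Ω × S2 => η p.1 * (ξ p.1 p.2 * f p.2)) (P.prod sphereMeasure) := by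
  have h1 : MemLp (fun p : Ω × S2 => η p.1) 2 (P.prod sphereMeasure) :=
    hη.comp_measurePreserving measurePreserving_fst
  have h2 : Integrable (fun p : Ω × S2 => η p.1 * ξ p.1 p.2) (P.prod sphereMeasure) :=
    h1.integrable_mul h
  have h3 := integrable_weight_mul h2 measurable_snd measurable_snd f 1
  refine h3.congr (ae_of_all _ fun p => ?_)
  simp only [ContinuousMap.one_apply]
  ring

variable [IsProbabilityMeasure P]

lemma IsTwoWeaklyIsotropic.memLp_prod (hm : IsRandomField ξ) (hiso : IsTwoWeaklyIsotropic P ξ) :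
    MemLp (fun p : Ω × S2 => ξ p.1 p.2) 2 (P.prod sphereMeasure) := by
  rw [memLp_two_iff_integrable_sq hm.aestronglyMeasurable,
    integrable_prod_iff' (hm.pow_const 2).aestronglyMeasurable]
  refine ⟨ae_of_all _ fun x => (hiso.1 x).integrable_sq, ?_⟩
  simp only [norm_pow, Real.norm_eq_abs, sq_abs, hiso.integral_sq]
  exact integrable_const _

lemma memLp_pair_fst (h : MemLp (fun p : Ω × S2 => ξ p.1 p.2) 2 (P.prod sphereMeasure)) :
    MemLp (fun p : Ω × (S2 × S2) => ξ p.1 p.2.1) 2 (P.prod (sphereMeasure.prod sphereMeasure)) :=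
  h.comp_measurePreserving
    ((MeasurePreserving.id P).prod (measurePreserving_fst (μ := sphereMeasure) (ν := sphereMeasure)))

lemma memLp_pair_snd (h : MemLp (fun p : Ω × S2 => ξ p.1 p.2) 2 (P.prod sphereMeasure)) :
    MemLp (fun p : Ω × (S2 × S2) => ξ p.1 p.2.2) 2 (P.prod (sphereMeasure.prod sphereMeasure)) :=
  h.comp_measurePreserving
    ((MeasurePreserving.id P).prod (measurePreserving_snd (μ := sphereMeasure) (ν := sphereMeasure)))

lemma integrable_pair (h : MemLp (fun p : Ω × S2 => ξ p.1 p.2) 2 (P.prod sphereMeasure)) :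
    Integrable (fun p : Ω × (S2 × S2) => ξ p.1 p.2.1 * ξ p.1 p.2.2)
      (P.prod (sphereMeasure.prod sphereMeasure)) :=
  (memLp_pair_fst h).integrable_mul (memLp_pair_snd h)

lemma integrable_covariance (h : MemLp (fun p : Ω × S2 => ξ p.1 p.2) 2 (P.prod sphereMeasure)) :
    Integrable (covariance P ξ) (sphereMeasure.prod sphereMeasure) :=
  (integrable_pair h).integral_prod_right

lemma integrable_pair_mul (h : MemLp (fun p : Ω × S2 => ξ p.1 p.2) 2 (P.prod sphereMeasure))
    (f g : C(S2, ℝ)) :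
    Integrable (fun p : Ω × (S2 × S2) => ξ p.1 p.2.1 * ξ p.1 p.2.2 * (f p.2.1 * g p.2.2))
      (P.prod (sphereMeasure.prod sphereMeasure)) :=
  integrable_weight_mul (integrable_pair h) (measurable_fst.comp measurable_snd)
    (measurable_snd.comp measurable_snd) f g

lemma integrable_pairing_mul_pairing
    (h : MemLp (fun p : Ω × S2 => ξ p.1 p.2) 2 (P.prod sphereMeasure)) (f g : C(S2, ℝ)) :
    Integrable (fun ω => pairing ξ f ω * pairing ξ g ω) P := by
  simp_rw [pairing_mul_pairing]
  exact (integrable_pair_mul h f g).integral_prod_left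

lemma integral_pairing_mul_pairing
    (h : MemLp (fun p : Ω × S2 => ξ p.1 p.2) 2 (P.prod sphereMeasure)) (f g : C(S2, ℝ)) :
    ∫ ω, pairing ξ f ω * pairing ξ g ω ∂P =
      integralForm (integrable_covariance h) measurable_fst measurable_snd f g := by
  simp_rw [pairing_mul_pairing]
  rw [integral_integral_swap (integrable_pair_mul h f g), integralForm_apply]
  congr 1
  funext p
  exact integral_mul_const _ _

lemma stronglyMeasurable_pairing (hm : IsRandomField ξ) (f : C(S2, ℝ)) :
    StronglyMeasurable (pairing ξ f) := by
  have : StronglyMeasurable fun p : Ω × S2 => ξ p.1 p.2 * f p.2 :=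
    (hm.mul (f.continuous.measurable.comp measurable_snd)).stronglyMeasurable
  exact this.integral_prod_right

lemma memLp_pairing (hm : IsRandomField ξ)
    (h : MemLp (fun p : Ω × S2 => ξ p.1 p.2) 2 (P.prod sphereMeasure)) (f : C(S2, ℝ)) :
    MemLp (pairing ξ f) 2 P := by
  rw [memLp_two_iff_integrable_sq (stronglyMeasurable_pairing hm f).aestronglyMeasurable]
  simpa only [sq] using integrable_pairing_mul_pairing h f f

/-- Fubini's theorem for the product of a square integrable variable and a coefficient. -/
lemma integral_mul_pairing (h : MemLp (fun p : Ω × S2 => ξ p.1 p.2) 2 (P.prod sphereMeasure))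
    (f : C(S2, ℝ)) {η : Ω → ℝ} (hη : MemLp η 2 P) :
    ∫ ω, η ω * pairing ξ f ω ∂P = ∫ x, (∫ ω, η ω * ξ ω x ∂P) * f x ∂sphereMeasure := by
  simp only [pairing, ← integral_const_mul]
  rw [integral_integral_swap (integrable_mul_continuous h f hη)]
  congr 1
  funext x
  rw [← integral_mul_const]
  congr 1
  funext ω
  ring

lemma integral_pairing_eq_zero
    (h : MemLp (fun p : Ω × S2 => ξ p.1 p.2) 2 (P.prod sphereMeasure))
    (hcen : IsCentred P ξ) (f : C(S2, ℝ)) : ∫ ω, pairing ξ f ω ∂P = 0 := by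
  have := integral_mul_pairing h f (η := fun _ => 1) (memLp_const 1)
  simpa [(hcen _).2] using this

/-- The coefficients of an isotropic field are uncorrelated, and their variance is given by the
angular power spectrum. -/
theorem IsTwoWeaklyIsotropic.integral_coeff_mul_coeff (hm : IsRandomField ξ)
    (hiso : IsTwoWeaklyIsotropic P ξ) {ℓ ℓ' : ℕ} {m m' : ℤ} (hmℓ : m ∈ orders ℓ) :
    ∫ ω, coeff ξ ℓ m ω * coeff ξ ℓ' m' ω ∂P =
      if ℓ = ℓ' ∧ m = m' then angularPowerSpectrum P ξ ℓ else 0 := by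
  have h := hiso.memLp_prod hm
  have hβ : IsInvariantForm (integralForm (integrable_covariance h) measurable_fst
      measurable_snd) := by
    refine isInvariantForm_integralForm _ _ _ (fun f g => ?_) (fun ρ hρ f g => ?_)
    · rw [← integralForm_apply (integrable_covariance h) measurable_fst measurable_snd,
        ← integralForm_apply (integrable_covariance h) measurable_fst measurable_snd,
        ← integral_pairing_mul_pairing h, ← integral_pairing_mul_pairing h]
      simp only [mul_comm]
    · have hmp : MeasurePreserving ((rotateEquiv ρ).prodCongr (rotateEquiv ρ))
          (sphereMeasure.prod sphereMeasure) (sphereMeasure.prod sphereMeasure) :=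
        (measurePreserving_rotateEquiv ρ).prod (measurePreserving_rotateEquiv ρ)
      rw [← hmp.integral_comp' (fun t => covariance P ξ t * (f t.1 * g t.2))]
      congr 1
      funext t
      rw [← hiso.covariance_rotate hρ t.1 t.2]
      rfl
  simp only [coeff_eq_pairing, angularPowerSpectrum, sq]
  rw [integral_pairing_mul_pairing h, hβ.Y_Y hmℓ]
  congr 1
  -- All $2\ell+1$ variances of degree $\ell$ coincide, hence equal their average, which is the
  -- definition of the power spectrum.
  rw [eq_div_iff (by positivity), Finset.sum_congr rfl fun m hm =>
    (integral_pairing_mul_pairing h _ _).trans (hβ.Y_Y_self hm), Finset.sum_const, nsmul_eq_mul,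
    card_orders]
  ring

lemma angularPowerSpectrum_nonneg (P : Measure Ω) (ξ : Ω → S2 → ℝ) (ℓ : ℕ) :
    0 ≤ angularPowerSpectrum P ξ ℓ :=
  div_nonneg (Finset.sum_nonneg fun _ _ => integral_nonneg fun _ => sq_nonneg _) (by positivity)

end SecondOrder

/-! ### Series of square integrable functions -/

section SquareSummable

variable {X : Type*} [MeasurableSpace X] {ν : Measure X} {f : ℕ → X → ℝ}

lemma eLpNorm_two_le_of_integral_sq_le {g : X → ℝ} (hg : MemLp g 2 ν) {s : ℝ} (hs : 0 ≤ s)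
    (h : ∫ x, g x ^ 2 ∂ν ≤ s ^ 2) : eLpNorm g 2 ν ≤ ENNReal.ofReal s := by
  rw [hg.eLpNorm_eq_integral_rpow_norm (by norm_num) (by norm_num)]
  refine ENNReal.ofReal_le_ofReal ?_
  have e : ∫ x, ‖g x‖ ^ (2 : ENNReal).toReal ∂ν = ∫ x, g x ^ 2 ∂ν := by simp
  rw [e, ENNReal.toReal_ofNat, ← one_div, ← Real.sqrt_eq_rpow]
  exact Real.sqrt_le_iff.2 ⟨hs, h⟩

lemma ae_summable_of_tsum_eLpNorm_ne_top (hf : ∀ n, MemLp (f n) 2 ν)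
    (h : ∑' n, eLpNorm (f n) 2 ν ≠ ⊤) : ∀ᵐ x ∂ν, Summable fun n => f n x := by
  filter_upwards [summable_norm_of_tsum_eLpNorm_ne_top (by norm_num) (fun n => (hf n).1) h] with x hx
  exact hx.of_norm

lemma aestronglyMeasurable_tsum (hf : ∀ n, MemLp (f n) 2 ν)
    (h : ∑' n, eLpNorm (f n) 2 ν ≠ ⊤) : AEStronglyMeasurable (fun x => ∑' n, f n x) ν := by
  refine aestronglyMeasurable_of_tendsto_ae atTop
    (f := fun N x => ∑ n ∈ Finset.range N, f n x) (fun N => ?_) ?_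
  · exact Finset.aestronglyMeasurable_fun_sum _ fun n _ => (hf n).1
  · filter_upwards [ae_summable_of_tsum_eLpNorm_ne_top hf h] with x hx
    exact hx.hasSum.tendsto_sum_nat

/-- Almost everywhere the error is minus the limit of the finite tail sums. Fatou's lemma for the
norm and the triangle inequality do the rest; the value $0$ of `tsum` at divergent points matters
only on a null set. -/
lemma eLpNorm_sum_sub_tsum_le (hf : ∀ n, MemLp (f n) 2 ν)
    (h : ∑' n, eLpNorm (f n) 2 ν ≠ ⊤) (N : ℕ) :
    eLpNorm (fun x => ∑ n ∈ Finset.range N, f n x - ∑' n, f n x) 2 ν ≤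
      ∑' n, eLpNorm (f (n + N)) 2 ν := by
  have hlim : ∀ᵐ x ∂ν, Tendsto (fun K => ∑ n ∈ Finset.range K, f (n + N) x) atTop
      (𝓝 (-(∑ n ∈ Finset.range N, f n x - ∑' n, f n x))) := by
    filter_upwards [ae_summable_of_tsum_eLpNorm_ne_top hf h] with x hx
    have h1 := ((summable_nat_add_iff N).2 hx).hasSum.tendsto_sum_nat
    rwa [show ∑' n, f (n + N) x = -(∑ n ∈ Finset.range N, f n x - ∑' n, f n x) by
      rw [← hx.sum_add_tsum_nat_add N]; ring] at h1
  have h2 := Lp.eLpNorm_lim_le_liminf_eLpNorm (p := 2)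
    (fun K => Finset.aestronglyMeasurable_fun_sum (Finset.range K) fun n _ => (hf (n + N)).1) _ hlim
  rw [← eLpNorm_neg]
  refine h2.trans (liminf_le_of_le (by isBoundedDefault) fun b hb => ?_)
  obtain ⟨K, hK⟩ := hb.exists
  refine hK.trans (le_trans ?_ (ENNReal.sum_le_tsum (Finset.range K)))
  have := eLpNorm_sum_le (μ := ν) (p := 2) (f := fun n => f (n + N)) (s := Finset.range K)
    (fun n _ => (hf (n + N)).1) (by norm_num)
  refine le_trans (le_of_eq ?_) this
  congr 1
  funext x
  simp

lemma tendsto_eLpNorm_sum_sub_tsum (hf : ∀ n, MemLp (f n) 2 ν)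
    (h : ∑' n, eLpNorm (f n) 2 ν ≠ ⊤) :
    Tendsto (fun N => eLpNorm (fun x => ∑ n ∈ Finset.range N, f n x - ∑' n, f n x) 2 ν) atTop
      (𝓝 0) :=
  tendsto_of_tendsto_of_tendsto_of_le_of_le tendsto_const_nhds
    (ENNReal.tendsto_sum_nat_add _ h) (fun _ => zero_le) (eLpNorm_sum_sub_tsum_le hf h)

lemma memLp_tsum (hf : ∀ n, MemLp (f n) 2 ν)
    (h : ∑' n, eLpNorm (f n) 2 ν ≠ ⊤) : MemLp (fun x => ∑' n, f n x) 2 ν := by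
  refine ⟨aestronglyMeasurable_tsum hf h, ?_⟩
  -- With an empty partial sum the error is the sum itself, up to sign.
  have := eLpNorm_sum_sub_tsum_le hf h 0
  simp only [Finset.range_zero, Finset.sum_empty, zero_sub, add_zero] at this
  rw [← eLpNorm_neg]
  exact this.trans_lt h.lt_top

end SquareSummable

/-! ### The parts of fixed degree -/

section DegreeParts

variable {Ω : Type*} [MeasurableSpace Ω] {P : Measure Ω} {ξ : Ω → S2 → ℝ}
  {G : ℕ → ℝ → ℂ} {t : ℝ}

omit [MeasurableSpace Ω] in
lemma degreePart_eq (ξ : Ω → S2 → ℝ) (G : ℕ → ℝ → ℂ) (t : ℝ) (ℓ : ℕ) (ω : Ω) (x : S2) :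
    degreePart ξ G t ℓ ω x = ∑ m ∈ orders ℓ, ((G ℓ t).re * Y ℓ m x) * coeff ξ ℓ m ω :=
  Finset.sum_congr rfl fun m _ => by ring

lemma measurable_coeff (hm : IsRandomField ξ) (ℓ : ℕ) (m : ℤ) : Measurable (coeff ξ ℓ m) := by
  rw [coeff_eq_pairing]
  exact (stronglyMeasurable_pairing hm _).measurable

lemma isRandomField_degreePart (hm : IsRandomField ξ) (ℓ : ℕ) :
    IsRandomField (degreePart ξ G t ℓ) :=
  Finset.measurable_fun_sum _ fun m _ =>
    (((measurable_coeff hm ℓ m).comp measurable_fst).mul_const _).mul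
      ((continuous_Y ℓ m).measurable.comp measurable_snd)

lemma isRandomField_homField (hm : IsRandomField ξ) : IsRandomField (homField ξ G t) :=
  Measurable.tsum fun ℓ => isRandomField_degreePart hm ℓ

/-- The bound for the variance of the part of degree `ℓ`. -/
def degreeScale (P : Measure Ω) (ξ : Ω → S2 → ℝ) (G : ℕ → ℝ → ℂ) (t : ℝ) (ℓ : ℕ) : ℝ :=
  ‖G ℓ t‖ * Real.sqrt ((2 * ℓ + 1) * angularPowerSpectrum P ξ ℓ)

lemma degreeScale_nonneg (P : Measure Ω) (ξ : Ω → S2 → ℝ) (G : ℕ → ℝ → ℂ) (t : ℝ) (ℓ : ℕ) :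
    0 ≤ degreeScale P ξ G t ℓ := mul_nonneg (norm_nonneg _) (Real.sqrt_nonneg _)

/-- By $2\ell+1\le3\ell$ the terms with $\ell\ge1$ are at most a constant times
$\ell^{(1-\kappa)/2}$, a summable majorant exactly when $\kappa>3$. -/
lemma summable_degreeScale {B C κ : ℝ} (hB0 : 0 ≤ B) (hB : ∀ ℓ, ‖G ℓ t‖ ≤ B) (hC : 0 < C)
    (hκ : 3 < κ)
    (hspec : ∀ ℓ : ℕ, 1 ≤ ℓ → angularPowerSpectrum P ξ ℓ ≤ C * (ℓ : ℝ) ^ (-κ)) :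
    Summable (degreeScale P ξ G t) := by
  have h := ((Real.summable_nat_rpow (p := (1 - κ) / 2)).2 (by linarith)).mul_left
    (B * Real.sqrt (3 * C))
  refine (summable_nat_add_iff 1).1 (Summable.of_nonneg_of_le
    (fun ℓ => degreeScale_nonneg P ξ G t (ℓ + 1)) (fun ℓ => ?_) ((summable_nat_add_iff 1).2 h))
  rw [degreeScale, mul_assoc]
  refine mul_le_mul (hB _) ?_ (Real.sqrt_nonneg _) hB0
  set n : ℝ := ((ℓ + 1 : ℕ) : ℝ) with hn
  have hn1 : 1 ≤ n := by rw [hn]; push_cast; linarith [(Nat.cast_nonneg ℓ : (0 : ℝ) ≤ ℓ)]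
  have e : n ^ ((1 - κ) / 2) = Real.sqrt (n ^ (1 - κ)) := by
    rw [Real.sqrt_eq_rpow, ← Real.rpow_mul (by linarith)]
    congr 1
    ring
  rw [e, ← Real.sqrt_mul (by positivity)]
  refine Real.sqrt_le_sqrt ?_
  have h1 := hspec (ℓ + 1) (by omega)
  rw [← hn] at h1
  calc (2 * n + 1) * angularPowerSpectrum P ξ (ℓ + 1) ≤ (3 * n) * (C * n ^ (-κ)) :=
        mul_le_mul (by linarith) h1 (angularPowerSpectrum_nonneg _ _ _) (by linarith)
    _ = 3 * C * n ^ (1 - κ) := by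
        rw [sub_eq_add_neg, Real.rpow_add (by linarith), Real.rpow_one]
        ring

variable [IsProbabilityMeasure P]

lemma memLp_coeff (hm : IsRandomField ξ) (hiso : IsTwoWeaklyIsotropic P ξ) (ℓ : ℕ) (m : ℤ) :
    MemLp (coeff ξ ℓ m) 2 P := by
  rw [coeff_eq_pairing]
  exact memLp_pairing hm (hiso.memLp_prod hm) _

lemma memLp_degreePart (hm : IsRandomField ξ) (hiso : IsTwoWeaklyIsotropic P ξ) (ℓ : ℕ) (x : S2) :
    MemLp (fun ω => degreePart ξ G t ℓ ω x) 2 P := by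
  simp only [degreePart_eq]
  exact memLp_finsetSum _ fun m _ => (memLp_coeff hm hiso ℓ m).const_mul _

lemma integral_degreePart_mul_degreePart (hm : IsRandomField ξ) (hiso : IsTwoWeaklyIsotropic P ξ)
    (ℓ ℓ' : ℕ) (x y : S2) :
    ∫ ω, degreePart ξ G t ℓ ω x * degreePart ξ G t ℓ' ω y ∂P =
      if ℓ = ℓ' then (G ℓ t).re ^ 2 * angularPowerSpectrum P ξ ℓ * zonalKernel ℓ x y else 0 := by
  have hint : ∀ m m', Integrable (fun ω => coeff ξ ℓ m ω * coeff ξ ℓ' m' ω) P := fun m m' =>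
    (memLp_coeff hm hiso ℓ m).integrable_mul (memLp_coeff hm hiso ℓ' m')
  have e : ∀ ω, degreePart ξ G t ℓ ω x * degreePart ξ G t ℓ' ω y =
      ∑ m ∈ orders ℓ, ∑ m' ∈ orders ℓ', ((G ℓ t).re * Y ℓ m x * ((G ℓ' t).re * Y ℓ' m' y)) *
        (coeff ξ ℓ m ω * coeff ξ ℓ' m' ω) := by
    intro ω
    rw [degreePart_eq, degreePart_eq, Finset.sum_mul_sum]
    exact Finset.sum_congr rfl fun m _ => Finset.sum_congr rfl fun m' _ => by ring
  simp_rw [e]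
  rw [integral_finsetSum _ fun m _ => integrable_finsetSum _ fun m' _ => (hint m m').const_mul _]
  have e2 : ∀ m ∈ orders ℓ, ∫ ω, ∑ m' ∈ orders ℓ',
      ((G ℓ t).re * Y ℓ m x * ((G ℓ' t).re * Y ℓ' m' y)) * (coeff ξ ℓ m ω * coeff ξ ℓ' m' ω) ∂P =
      ∑ m' ∈ orders ℓ', ((G ℓ t).re * Y ℓ m x * ((G ℓ' t).re * Y ℓ' m' y)) *
        (if ℓ = ℓ' ∧ m = m' then angularPowerSpectrum P ξ ℓ else 0) := by
    intro m hmℓ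
    rw [integral_finsetSum _ fun m' _ => (hint m m').const_mul _]
    refine Finset.sum_congr rfl fun m' _ => ?_
    rw [integral_const_mul, hiso.integral_coeff_mul_coeff hm hmℓ]
  rw [Finset.sum_congr rfl e2]
  split_ifs with h
  · subst h
    rw [zonalKernel, Finset.mul_sum]
    refine Finset.sum_congr rfl fun m hmℓ => ?_
    rw [Finset.sum_eq_single_of_mem m hmℓ (fun m' _ hne => by simp [hne.symm])]
    simp
    ring
  · simp [h]

lemma integral_degreePart_sq_le (hm : IsRandomField ξ) (hiso : IsTwoWeaklyIsotropic P ξ)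
    (ℓ : ℕ) (x : S2) :
    ∫ ω, degreePart ξ G t ℓ ω x ^ 2 ∂P ≤ degreeScale P ξ G t ℓ ^ 2 := by
  simp only [sq (degreePart ξ G t ℓ _ x)]
  rw [integral_degreePart_mul_degreePart hm hiso, if_pos rfl, zonalKernel_self, degreeScale,
    mul_pow, Real.sq_sqrt (mul_nonneg (by positivity) (angularPowerSpectrum_nonneg _ _ _)),
    mul_assoc, mul_comm (angularPowerSpectrum P ξ ℓ)]
  refine mul_le_mul_of_nonneg_right ?_
    (mul_nonneg (by positivity) (angularPowerSpectrum_nonneg _ _ _))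
  rw [← sq_abs (G ℓ t).re]
  exact pow_le_pow_left₀ (abs_nonneg _) (Complex.abs_re_le_norm _) 2

lemma isTwoWeaklyIsotropic_degreePart (hm : IsRandomField ξ) (hiso : IsTwoWeaklyIsotropic P ξ)
    (hcen : IsCentred P ξ) (ℓ : ℕ) :
    IsTwoWeaklyIsotropic P (degreePart ξ G t ℓ) ∧ IsCentred P (degreePart ξ G t ℓ) := by
  have hmean : ∀ x, ∫ ω, degreePart ξ G t ℓ ω x ∂P = 0 := by
    intro x
    simp only [degreePart_eq]
    rw [integral_finsetSum _ fun m _ => ((memLp_coeff hm hiso ℓ m).integrable (by norm_num)).const_mul _]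
    refine Finset.sum_eq_zero fun m _ => ?_
    rw [integral_const_mul, coeff_eq_pairing, integral_pairing_eq_zero (hiso.memLp_prod hm) hcen,
      mul_zero]
  refine ⟨⟨memLp_degreePart hm hiso ℓ, fun ρ _ x y => ⟨by rw [hmean, hmean], ?_⟩⟩,
    fun x => ⟨(memLp_degreePart hm hiso ℓ x).integrable (by norm_num), hmean x⟩⟩
  rw [integral_degreePart_mul_degreePart hm hiso, integral_degreePart_mul_degreePart hm hiso,
    zonalKernel_rotate]

lemma eLpNorm_degreePart_le (hm : IsRandomField ξ) (hiso : IsTwoWeaklyIsotropic P ξ)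
    (ℓ : ℕ) (x : S2) :
    eLpNorm (fun ω => degreePart ξ G t ℓ ω x) 2 P ≤ ENNReal.ofReal (degreeScale P ξ G t ℓ) :=
  eLpNorm_two_le_of_integral_sq_le (memLp_degreePart hm hiso ℓ x) (degreeScale_nonneg _ _ _ _ _)
    (integral_degreePart_sq_le hm hiso ℓ x)

lemma memLp_prod_degreePart (hm : IsRandomField ξ) (hiso : IsTwoWeaklyIsotropic P ξ)
    (hcen : IsCentred P ξ) (ℓ : ℕ) :
    MemLp (fun p : Ω × S2 => degreePart ξ G t ℓ p.1 p.2) 2 (P.prod sphereMeasure) :=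
  (isTwoWeaklyIsotropic_degreePart hm hiso hcen ℓ).1.memLp_prod (isRandomField_degreePart hm ℓ)

lemma eLpNorm_prod_degreePart_le (hm : IsRandomField ξ) (hiso : IsTwoWeaklyIsotropic P ξ)
    (hcen : IsCentred P ξ) (ℓ : ℕ) :
    eLpNorm (fun p : Ω × S2 => degreePart ξ G t ℓ p.1 p.2) 2 (P.prod sphereMeasure) ≤
      ENNReal.ofReal (degreeScale P ξ G t ℓ) := by
  have hL := memLp_prod_degreePart (G := G) (t := t) hm hiso hcen ℓ
  refine eLpNorm_two_le_of_integral_sq_le hL (degreeScale_nonneg _ _ _ _ _) ?_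
  rw [integral_prod_symm _ hL.integrable_sq]
  refine (integral_mono_of_nonneg (ae_of_all _ fun x => integral_nonneg fun ω => sq_nonneg _)
    (integrable_const (degreeScale P ξ G t ℓ ^ 2))
    (ae_of_all _ fun x => integral_degreePart_sq_le hm hiso ℓ x)).trans ?_
  simp

omit [IsProbabilityMeasure P] in
lemma tsum_ne_top_of_le_degreeScale {N : ℕ → ENNReal} (hs : Summable (degreeScale P ξ G t))
    (h : ∀ ℓ, N ℓ ≤ ENNReal.ofReal (degreeScale P ξ G t ℓ)) : ∑' ℓ, N ℓ ≠ ⊤ := by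
  refine ne_top_of_le_ne_top ?_ (ENNReal.tsum_le_tsum h)
  rw [← ENNReal.ofReal_tsum_of_nonneg (degreeScale_nonneg P ξ G t) hs]
  exact ENNReal.ofReal_ne_top

lemma tsum_eLpNorm_degreePart_ne_top (hm : IsRandomField ξ) (hiso : IsTwoWeaklyIsotropic P ξ)
    (hs : Summable (degreeScale P ξ G t)) (x : S2) :
    ∑' ℓ, eLpNorm (fun ω => degreePart ξ G t ℓ ω x) 2 P ≠ ⊤ :=
  tsum_ne_top_of_le_degreeScale hs fun ℓ => eLpNorm_degreePart_le hm hiso ℓ x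

lemma tsum_eLpNorm_prod_degreePart_ne_top (hm : IsRandomField ξ)
    (hiso : IsTwoWeaklyIsotropic P ξ) (hcen : IsCentred P ξ)
    (hs : Summable (degreeScale P ξ G t)) :
    ∑' ℓ, eLpNorm (fun p : Ω × S2 => degreePart ξ G t ℓ p.1 p.2) 2 (P.prod sphereMeasure) ≠ ⊤ :=
  tsum_ne_top_of_le_degreeScale hs fun ℓ => eLpNorm_prod_degreePart_le hm hiso hcen ℓ

/-! ### The coefficients of the series -/

omit [MeasurableSpace Ω] in
lemma integral_degreePart_mul_Y (ω : Ω) {ℓ : ℕ} {m : ℤ} (hmℓ : m ∈ orders ℓ) (ℓ' : ℕ) :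
    ∫ x, degreePart ξ G t ℓ' ω x * Y ℓ m x ∂sphereMeasure =
      if ℓ' = ℓ then (G ℓ t).re * coeff ξ ℓ m ω else 0 := by
  have hint : ∀ m', Integrable (fun x => Y ℓ' m' x * Y ℓ m x) sphereMeasure := fun m' =>
    ((continuous_Y ℓ' m').mul (continuous_Y ℓ m)).integrable_of_hasCompactSupport
      (HasCompactSupport.of_compactSpace _)
  have e : ∀ x, degreePart ξ G t ℓ' ω x * Y ℓ m x =
      ∑ m' ∈ orders ℓ', (coeff ξ ℓ' m' ω * (G ℓ' t).re) * (Y ℓ' m' x * Y ℓ m x) := by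
    intro x
    rw [degreePart, Finset.sum_mul]
    exact Finset.sum_congr rfl fun _ _ => by ring
  simp_rw [e]
  rw [integral_finsetSum _ fun m' _ => (hint m').const_mul _]
  have e2 : ∀ m' ∈ orders ℓ', ∫ x, (coeff ξ ℓ' m' ω * (G ℓ' t).re) * (Y ℓ' m' x * Y ℓ m x)
      ∂sphereMeasure = (coeff ξ ℓ' m' ω * (G ℓ' t).re) * if ℓ' = ℓ ∧ m' = m then 1 else 0 :=
    fun m' hm' => by rw [integral_const_mul, integral_Y_mul_Y_eq_ite hm']
  rw [Finset.sum_congr rfl e2]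
  split_ifs with h
  · subst h
    rw [Finset.sum_eq_single_of_mem m hmℓ (fun m' _ hne => by simp [hne])]
    simp [mul_comm]
  · simp [h]

/-- The sum may be integrated term by term over the sphere for almost every $\omega$: by Tonelli the
expectation of $\sum_{\ell'}\int|\cdot|$ is finite, so the sum is finite almost surely.
Orthonormality then leaves a single degree and order. -/
lemma ae_coeff_homField (hm : IsRandomField ξ) (hiso : IsTwoWeaklyIsotropic P ξ)
    (hcen : IsCentred P ξ) (hs : Summable (degreeScale P ξ G t)) {ℓ : ℕ} {m : ℤ}
    (hmℓ : m ∈ orders ℓ) :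
    ∀ᵐ ω ∂P, coeff (homField ξ G t) ℓ m ω = (G ℓ t).re * coeff ξ ℓ m ω := by
  have hmeas : ∀ ℓ', Measurable fun p : Ω × S2 => degreePart ξ G t ℓ' p.1 p.2 * Y ℓ m p.2 :=
    fun ℓ' => (isRandomField_degreePart hm ℓ').mul ((continuous_Y ℓ m).measurable.comp measurable_snd)
  have hle : ∀ ℓ', ∫⁻ p, ‖degreePart ξ G t ℓ' p.1 p.2 * Y ℓ m p.2‖ₑ ∂(P.prod sphereMeasure) ≤
      ‖continuousY ℓ m‖ₑ * eLpNorm (fun p : Ω × S2 => degreePart ξ G t ℓ' p.1 p.2) 2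
        (P.prod sphereMeasure) := by
    intro ℓ'
    have h1 := eLpNorm_le_eLpNorm_of_exponent_le (p := 1) (q := 2) (by norm_num)
      (memLp_prod_degreePart (G := G) (t := t) hm hiso hcen ℓ').1
    refine le_trans ?_ (mul_le_mul_right h1 _)
    rw [eLpNorm_one_eq_lintegral_enorm, ← lintegral_const_mul' _ _ enorm_ne_top]
    refine lintegral_mono fun p => ?_
    rw [enorm_mul, mul_comm, ← continuousY_apply]
    refine mul_le_mul_left ?_ _
    rw [enorm_le_iff_norm_le]
    exact (continuousY ℓ m).norm_coe_le_norm _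
  have htop : ∫⁻ ω, ∑' ℓ', ∫⁻ x, ‖degreePart ξ G t ℓ' ω x * Y ℓ m x‖ₑ ∂sphereMeasure ∂P ≠ ⊤ := by
    rw [lintegral_tsum fun ℓ' => ((hmeas ℓ').enorm.lintegral_prod_right').aemeasurable]
    simp_rw [← lintegral_prod _ (hmeas _).enorm.aemeasurable]
    refine ne_top_of_le_ne_top ?_ (ENNReal.tsum_le_tsum hle)
    rw [ENNReal.tsum_mul_left]
    exact ENNReal.mul_ne_top enorm_ne_top (tsum_eLpNorm_prod_degreePart_ne_top hm hiso hcen hs)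
  have hmeas2 : Measurable fun ω => ∑' ℓ', ∫⁻ x, ‖degreePart ξ G t ℓ' ω x * Y ℓ m x‖ₑ
      ∂sphereMeasure := Measurable.tsum fun ℓ' => (hmeas ℓ').enorm.lintegral_prod_right'
  filter_upwards [ae_lt_top hmeas2 htop] with ω hω
  simp only [coeff, homField, ← tsum_mul_right]
  have hsec : ∀ ℓ', AEStronglyMeasurable (fun x => degreePart ξ G t ℓ' ω x * Y ℓ m x)
      sphereMeasure := fun ℓ' => ((hmeas ℓ').comp measurable_prodMk_left).aestronglyMeasurable
  rw [integral_tsum hsec hω.ne]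
  simp_rw [integral_degreePart_mul_Y ω hmℓ]
  rw [tsum_eq_single ℓ (fun ℓ' h => if_neg h), if_pos rfl]
  rfl

end DegreeParts

/-! ### The Gaussian space of a centred Gaussian process -/

section GaussianSpace

variable {Ω : Type*} [MeasurableSpace Ω] {P : Measure Ω} {T : Type*} {X : T → Ω → ℝ}

/-- The closed linear span of the variables of a square integrable process. -/
def gaussianSpace (hX : ∀ x, MemLp (X x) 2 P) : Submodule ℝ (Lp ℝ 2 P) :=
  (Submodule.span ℝ (Set.range fun x => (hX x).toLp)).topologicalClosure

/-- The closed span is the double orthogonal complement. Membership of an integral over the sphere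
thus becomes a Fubini argument, with no approximation by Riemann sums. -/
lemma mem_gaussianSpace_of_orthogonal (hX : ∀ x, MemLp (X x) 2 P) {f : Lp ℝ 2 P}
    (h : ∀ η : Lp ℝ 2 P, (∀ x, ∫ ω, η ω * X x ω ∂P = 0) → ∫ ω, η ω * f ω ∂P = 0) :
    f ∈ gaussianSpace hX := by
  rw [gaussianSpace, ← Submodule.orthogonal_orthogonal_eq_closure, Submodule.mem_orthogonal]
  intro η hη
  rw [L2.inner_def]
  have e : ∀ a b : ℝ, inner ℝ a b = a * b := fun a b => by simp [mul_comm]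
  simp only [e]
  refine h η fun x => ?_
  have h1 := (Submodule.mem_orthogonal' _ _).1 hη _ (Submodule.subset_span ⟨x, rfl⟩)
  rw [L2.inner_def] at h1
  simp only [e] at h1
  rw [← h1]
  refine integral_congr_ae ?_
  filter_upwards [(hX x).coeFn_toLp] with ω hω
  rw [hω]

lemma norm_sq_eq_integral_sq (f : Lp ℝ 2 P) : ‖f‖ ^ 2 = ∫ ω, f ω ^ 2 ∂P := by
  rw [← real_inner_self_eq_norm_sq, L2.inner_def]
  simp [sq]

variable [IsProbabilityMeasure P]

lemma integral_eq_zero_of_mem_gaussianSpace (hX : ∀ x, MemLp (X x) 2 P)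
    (hcen : ∀ x, ∫ ω, X x ω ∂P = 0) {f : Lp ℝ 2 P} (hf : f ∈ gaussianSpace hX) :
    ∫ ω, f ω ∂P = 0 := by
  have hone : MemLp (fun _ : Ω => (1 : ℝ)) 2 P := memLp_const 1
  have hinner : ∀ g : Lp ℝ 2 P, inner ℝ hone.toLp g = ∫ ω, g ω ∂P := by
    intro g
    rw [L2.inner_def]
    refine integral_congr_ae ?_
    filter_upwards [hone.coeFn_toLp] with ω hω
    rw [hω]
    simp
  have hle : gaussianSpace hX ≤ (Submodule.span ℝ {hone.toLp})ᗮ := by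
    refine Submodule.topologicalClosure_minimal _ (Submodule.span_le.2 ?_)
      (Submodule.isClosed_orthogonal _)
    rintro _ ⟨x, rfl⟩
    rw [SetLike.mem_coe, Submodule.mem_orthogonal_singleton_iff_inner_right, hinner, ← hcen x]
    exact integral_congr_ae (hX x).coeFn_toLp
  rw [← hinner]
  exact (Submodule.mem_orthogonal_singleton_iff_inner_right).1 (hle hf)

lemma integral_norm_le_norm (f : Lp ℝ 2 P) : ∫ ω, ‖f ω‖ ∂P ≤ ‖f‖ := by
  rw [integral_norm_eq_lintegral_enorm (Lp.aestronglyMeasurable f), Lp.norm_def,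
    ← eLpNorm_one_eq_lintegral_enorm]
  exact ENNReal.toReal_mono (Lp.eLpNorm_ne_top f)
    (eLpNorm_le_eLpNorm_of_exponent_le (by norm_num) (Lp.aestronglyMeasurable f))

lemma integrable_cexp_mul_I {f : Ω → ℝ} (hf : AEStronglyMeasurable f P) :
    Integrable (fun ω => Complex.exp (f ω * Complex.I)) P := by
  refine Integrable.of_bound (C := 1) ?_ (ae_of_all _ fun ω => ?_)
  · exact (by fun_prop : Continuous fun x : ℝ => Complex.exp (x * Complex.I)).comp_aestronglyMeasurable hf
  · rw [Complex.norm_exp_ofReal_mul_I]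

lemma norm_cexp_sub_cexp_le (a b : ℝ) :
    ‖Complex.exp (a * Complex.I) - Complex.exp (b * Complex.I)‖ ≤ ‖a - b‖ := by
  have e : Complex.exp (a * Complex.I) - Complex.exp (b * Complex.I) =
      Complex.exp (b * Complex.I) * (Complex.exp (Complex.I * ((a - b : ℝ) : ℂ)) - 1) := by
    rw [mul_sub, ← Complex.exp_add, mul_one]
    congr 2
    push_cast
    ring
  rw [e, norm_mul, Complex.norm_exp_ofReal_mul_I, one_mul]
  exact Real.norm_exp_I_mul_ofReal_sub_one_le

/-- The map is 1-Lipschitz, as $|e^{ia}-e^{ib}|\le|a-b|$ and the $L_1$ norm is at most the $L_2$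
norm under a probability measure. It lets the Gaussian characteristic function pass to $L_2$ limits.
-/
lemma continuous_integral_cexp :
    Continuous fun f : Lp ℝ 2 P => ∫ ω, Complex.exp (f ω * Complex.I) ∂P := by
  refine (LipschitzWith.of_dist_le_mul (K := 1) fun f g => ?_).continuous
  rw [dist_eq_norm, dist_eq_norm, NNReal.coe_one, one_mul,
    ← integral_sub (integrable_cexp_mul_I (Lp.aestronglyMeasurable f))
      (integrable_cexp_mul_I (Lp.aestronglyMeasurable g))]
  refine (norm_integral_le_integral_norm _).trans (le_trans ?_ (integral_norm_le_norm (f - g)))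
  refine integral_mono_ae ((integrable_cexp_mul_I (Lp.aestronglyMeasurable f)).sub
    (integrable_cexp_mul_I (Lp.aestronglyMeasurable g))).norm
    ((Lp.memLp (f - g)).integrable (by norm_num)).norm ?_
  filter_upwards [Lp.coeFn_sub f g] with ω hω
  rw [hω]
  exact norm_cexp_sub_cexp_le _ _

/-- Every element of the Gaussian space is a centred Gaussian variable. -/
lemma integral_cexp_of_mem_gaussianSpace (hX : ∀ x, MemLp (X x) 2 P)
    (hcen : ∀ x, ∫ ω, X x ω ∂P = 0) (hG : IsGaussianProcess X P) {f : Lp ℝ 2 P}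
    (hf : f ∈ gaussianSpace hX) :
    ∫ ω, Complex.exp (f ω * Complex.I) ∂P = Complex.exp (-((‖f‖ ^ 2 : ℝ) : ℂ) / 2) := by
  -- Both sides are continuous in $f$, so it suffices to treat finite linear combinations of the
  -- process. These are Gaussian with mean zero and variance $\|f\|^2$.
  have hclosed : IsClosed {f : Lp ℝ 2 P | ∫ ω, Complex.exp (f ω * Complex.I) ∂P =
      Complex.exp (-((‖f‖ ^ 2 : ℝ) : ℂ) / 2)} :=
    isClosed_eq continuous_integral_cexp (by fun_prop)
  refine closure_minimal (s := (Submodule.span ℝ (Set.range fun x => (hX x).toLp) : Set (Lp ℝ 2 P)))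
    ?_ hclosed hf
  intro f hf
  have hmean := integral_eq_zero_of_mem_gaussianSpace hX hcen
    (Submodule.le_topologicalClosure _ hf)
  obtain ⟨c, rfl⟩ := Finsupp.mem_span_range_iff_exists_finsupp.1 hf
  set f : Lp ℝ 2 P := c.sum fun x a => a • (hX x).toLp with hfdef
  have hae : ∀ᵐ ω ∂P, ∑ x ∈ c.support, c x • X x ω = f ω := by
    have h1 : ∀ x, ∀ᵐ ω ∂P, (c x • (hX x).toLp : Lp ℝ 2 P) ω = c x • X x ω := by
      intro x
      filter_upwards [Lp.coeFn_smul (c x) (hX x).toLp, (hX x).coeFn_toLp] with ω h2 h3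
      rw [h2, Pi.smul_apply, h3]
    have h4 : ∀ᵐ ω ∂P, ∀ x ∈ c.support, (c x • (hX x).toLp : Lp ℝ 2 P) ω = c x • X x ω :=
      (ae_ball_iff c.support.countable_toSet).2 fun x _ => h1 x
    filter_upwards [h4, Lp.coeFn_fun_finsetSum c.support fun x => (c x • (hX x).toLp : Lp ℝ 2 P)]
      with ω h5 h6
    rw [hfdef, Finsupp.sum, h6]
    exact (Finset.sum_congr rfl h5).symm
  have hlaw : HasGaussianLaw (f : Ω → ℝ) P :=
    ((hG.smul c).hasGaussianLaw_fun_sum (I := c.support)).congr hae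
  have h := hlaw.charFun_map_eq 1
  rw [charFun_apply_real, integral_map hlaw.aemeasurable (by fun_prop)] at h
  have e : (fun ω => inner ℝ (1 : ℝ) (f ω)) = f := by funext ω; simp
  simp only [e, Complex.ofReal_one, one_mul] at h
  rw [hmean, variance_of_integral_eq_zero hlaw.aemeasurable hmean, ← norm_sq_eq_integral_sq] at h
  rw [Set.mem_ofPred_eq, h]
  congr 1
  simp
  ring

/-- A family of variables in the Gaussian space of a centred Gaussian process is a Gaussian
process. -/
theorem isGaussianProcess_of_mem_gaussianSpace {S : Type*} (hX : ∀ x, MemLp (X x) 2 P)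
    (hcen : ∀ x, ∫ ω, X x ω ∂P = 0) (hG : IsGaussianProcess X P) {U : S → Ω → ℝ}
    (hU : ∀ s, MemLp (U s) 2 P) (hmem : ∀ s, (hU s).toLp ∈ gaussianSpace hX) :
    IsGaussianProcess U P := by
  classical
  refine ⟨fun I => ?_⟩
  have hmeas : AEMeasurable (fun ω => I.restrict fun s => U s ω) P :=
    aemeasurable_pi_iff.2 fun s => (hU s).1.aemeasurable
  rw [hasGaussianLaw_iff_charFunDual_map_eq hmeas]
  intro L
  -- The functional $L$ of the vector is a linear combination with these coefficients, hence again
  -- an element of the Gaussian space. Since $L$ is arbitrary, the characteristic function of that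
  -- element at $1$ is enough.
  let c : I → ℝ := fun i => L (Pi.single i 1)
  let f : Lp ℝ 2 P := ∑ i : I, c i • (hU i).toLp
  have hf : f ∈ gaussianSpace hX :=
    Submodule.sum_mem _ fun i _ => Submodule.smul_mem _ _ (hmem i)
  have hae : ∀ᵐ ω ∂P, (L ∘ fun ω => I.restrict fun s => U s ω) ω = f ω := by
    have h1 : ∀ᵐ ω ∂P, ∀ i : I, (c i • (hU i).toLp : Lp ℝ 2 P) ω = c i • U i ω := by
      rw [ae_all_iff]
      intro i
      filter_upwards [Lp.coeFn_smul (c i) (hU i).toLp, (hU i).coeFn_toLp] with ω h2 h3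
      rw [h2, Pi.smul_apply, h3]
    filter_upwards [h1, Lp.coeFn_fun_finsetSum Finset.univ
      fun i : I => (c i • (hU i).toLp : Lp ℝ 2 P)] with ω h5 h6
    rw [h6, Finset.sum_congr rfl fun i _ => h5 i, Function.comp_apply,
      pi_eq_sum_univ' (I.restrict fun s => U s ω), map_sum]
    refine Finset.sum_congr rfl fun i _ => ?_
    rw [map_smul, smul_eq_mul, smul_eq_mul, mul_comm]
    congr 2
  have hmean : ∫ ω, (L ∘ fun ω => I.restrict fun s => U s ω) ω ∂P = 0 :=
    (integral_congr_ae hae).trans (integral_eq_zero_of_mem_gaussianSpace hX hcen hf)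
  have hvar : variance (L ∘ fun ω => I.restrict fun s => U s ω) P = ‖f‖ ^ 2 := by
    rw [variance_of_integral_eq_zero (L.continuous.measurable.comp_aemeasurable hmeas) hmean,
      norm_sq_eq_integral_sq]
    refine integral_congr_ae ?_
    filter_upwards [hae] with ω hω
    rw [hω]
  rw [hmean, hvar, charFunDual_apply, integral_map hmeas (by fun_prop)]
  have h := integral_cexp_of_mem_gaussianSpace hX hcen hG hf
  have h2 : ∫ ω, Complex.exp (L (I.restrict fun s => U s ω) * Complex.I) ∂P =
      ∫ ω, Complex.exp (f ω * Complex.I) ∂P := by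
    refine integral_congr_ae ?_
    filter_upwards [hae] with ω hω
    rw [← hω, Function.comp_apply]
  rw [h2, h]
  congr 1
  simp
  ring

end GaussianSpace

/-! ### The homogeneous solution -/

section HomField

variable {Ω : Type*} [MeasurableSpace Ω] {P : Measure Ω} [IsProbabilityMeasure P]
  {ξ : Ω → S2 → ℝ} {G : ℕ → ℝ → ℂ} {t : ℝ}

/-- A variable $\eta$ orthogonal to every $\xi(x)$ is orthogonal to every coefficient, because
Fubini gives $\mathbb E[\eta\,\widehat\xi_{\ell,m}]=\int\mathbb
E[\eta\,\xi(x)]\,Y_{\ell,m}(x)\,d\mu(x)=0$. -/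
lemma toLp_degreePart_mem_gaussianSpace (hm : IsRandomField ξ) (hiso : IsTwoWeaklyIsotropic P ξ)
    (ℓ : ℕ) (x : S2) :
    (memLp_degreePart (G := G) (t := t) hm hiso ℓ x).toLp ∈
      gaussianSpace (X := fun (x : S2) ω => ξ ω x) hiso.1 := by
  refine mem_gaussianSpace_of_orthogonal _ fun η hη => ?_
  have hint : ∀ m, Integrable (fun ω => η ω * coeff ξ ℓ m ω) P := fun m =>
    (Lp.memLp η).integrable_mul (memLp_coeff hm hiso ℓ m)
  have h0 : ∀ m, ∫ ω, η ω * coeff ξ ℓ m ω ∂P = 0 := by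
    intro m
    rw [coeff_eq_pairing, integral_mul_pairing (hiso.memLp_prod hm) _ (Lp.memLp η)]
    simp [hη]
  calc ∫ ω, η ω * MemLp.toLp _ (memLp_degreePart (G := G) (t := t) hm hiso ℓ x) ω ∂P
      = ∫ ω, ∑ m ∈ orders ℓ, ((G ℓ t).re * Y ℓ m x) * (η ω * coeff ξ ℓ m ω) ∂P := by
        refine integral_congr_ae ?_
        filter_upwards [(memLp_degreePart (G := G) (t := t) hm hiso ℓ x).coeFn_toLp] with ω hω
        rw [hω, degreePart_eq, Finset.mul_sum]
        exact Finset.sum_congr rfl fun m _ => by ring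
    _ = 0 := by
        rw [integral_finsetSum _ fun m _ => (hint m).const_mul _]
        exact Finset.sum_eq_zero fun m _ => by rw [integral_const_mul, h0, mul_zero]

lemma memLp_homField (hm : IsRandomField ξ) (hiso : IsTwoWeaklyIsotropic P ξ)
    (hs : Summable (degreeScale P ξ G t)) (x : S2) :
    MemLp (fun ω => homField ξ G t ω x) 2 P :=
  memLp_tsum (fun ℓ => memLp_degreePart hm hiso ℓ x) (tsum_eLpNorm_degreePart_ne_top hm hiso hs x)

lemma tendsto_sum_toLp_degreePart (hm : IsRandomField ξ) (hiso : IsTwoWeaklyIsotropic P ξ)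
    (hs : Summable (degreeScale P ξ G t)) (x : S2) :
    Tendsto (fun N => ∑ ℓ ∈ Finset.range N, (memLp_degreePart (G := G) (t := t) hm hiso ℓ x).toLp)
      atTop (𝓝 (memLp_homField hm hiso hs x).toLp) := by
  rw [Lp.tendsto_Lp_iff_tendsto_eLpNorm]
  refine (tendsto_eLpNorm_sum_sub_tsum (fun ℓ => memLp_degreePart hm hiso ℓ x)
    (tsum_eLpNorm_degreePart_ne_top hm hiso hs x)).congr fun N => eLpNorm_congr_ae ?_
  have h1 : ∀ᵐ ω ∂P, ∀ ℓ, MemLp.toLp _ (memLp_degreePart (G := G) (t := t) hm hiso ℓ x) ω =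
      degreePart ξ G t ℓ ω x :=
    ae_all_iff.2 fun ℓ => (memLp_degreePart (G := G) (t := t) hm hiso ℓ x).coeFn_toLp
  filter_upwards [h1, Lp.coeFn_fun_finsetSum (Finset.range N)
    fun ℓ => (memLp_degreePart (G := G) (t := t) hm hiso ℓ x).toLp] with ω h2 h3
  rw [Pi.sub_apply, h3, Finset.sum_congr rfl fun ℓ _ => h2 ℓ]
  rfl

lemma toLp_homField_mem_gaussianSpace (hm : IsRandomField ξ) (hiso : IsTwoWeaklyIsotropic P ξ)
    (hs : Summable (degreeScale P ξ G t)) (x : S2) :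
    (memLp_homField hm hiso hs x).toLp ∈ gaussianSpace (X := fun (x : S2) ω => ξ ω x) hiso.1 :=
  (Submodule.isClosed_topologicalClosure _).mem_of_tendsto
    (tendsto_sum_toLp_degreePart hm hiso hs x) (Eventually.of_forall fun _ =>
      Submodule.sum_mem _ fun ℓ _ => toLp_degreePart_mem_gaussianSpace hm hiso ℓ x)

lemma isCentred_homField (hm : IsRandomField ξ) (hiso : IsTwoWeaklyIsotropic P ξ)
    (hcen : IsCentred P ξ) (hs : Summable (degreeScale P ξ G t)) :
    IsCentred P (homField ξ G t) := fun x =>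
  ⟨(memLp_homField hm hiso hs x).integrable (by norm_num), by
    rw [← integral_congr_ae (memLp_homField hm hiso hs x).coeFn_toLp]
    exact integral_eq_zero_of_mem_gaussianSpace hiso.1 (fun x => (hcen x).2)
      (toLp_homField_mem_gaussianSpace hm hiso hs x)⟩

omit [IsProbabilityMeasure P] in
lemma inner_toLp {f g : Ω → ℝ} (hf : MemLp f 2 P) (hg : MemLp g 2 P) :
    inner ℝ hf.toLp hg.toLp = ∫ ω, f ω * g ω ∂P := by
  rw [L2.inner_def]
  refine integral_congr_ae ?_
  filter_upwards [hf.coeFn_toLp, hg.coeFn_toLp] with ω h1 h2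
  rw [h1, h2]
  simp [mul_comm]

/-- Covariances are $L_2$ inner products, so they are limits of those of the partial sums, which
depend on the points only through the rotation-invariant kernels `zonalKernel`. -/
lemma integral_homField_mul_homField_rotate (hm : IsRandomField ξ)
    (hiso : IsTwoWeaklyIsotropic P ξ) (hs : Summable (degreeScale P ξ G t))
    (ρ : E3 ≃ₗᵢ[ℝ] E3) (x y : S2) :
    ∫ ω, homField ξ G t ω x * homField ξ G t ω y ∂P =
      ∫ ω, homField ξ G t ω (rotate ρ x) * homField ξ G t ω (rotate ρ y) ∂P := by
  have hlim := fun x y => ((tendsto_sum_toLp_degreePart hm hiso hs x).inner (𝕜 := ℝ)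
    (tendsto_sum_toLp_degreePart hm hiso hs y))
  rw [← inner_toLp (memLp_homField hm hiso hs x) (memLp_homField hm hiso hs y),
    ← inner_toLp (memLp_homField hm hiso hs (rotate ρ x)) (memLp_homField hm hiso hs (rotate ρ y))]
  refine tendsto_nhds_unique (hlim x y) ((hlim (rotate ρ x) (rotate ρ y)).congr fun N => ?_)
  simp only [sum_inner, inner_sum, inner_toLp, integral_degreePart_mul_degreePart hm hiso,
    zonalKernel_rotate]

lemma isTwoWeaklyIsotropic_homField (hm : IsRandomField ξ) (hiso : IsTwoWeaklyIsotropic P ξ)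
    (hcen : IsCentred P ξ) (hs : Summable (degreeScale P ξ G t)) :
    IsTwoWeaklyIsotropic P (homField ξ G t) :=
  ⟨memLp_homField hm hiso hs, fun ρ _ x y =>
    ⟨by rw [(isCentred_homField hm hiso hcen hs x).2, (isCentred_homField hm hiso hcen hs _).2],
      integral_homField_mul_homField_rotate hm hiso hs ρ x y⟩⟩

lemma isGaussianField_homField (hm : IsRandomField ξ) (hiso : IsTwoWeaklyIsotropic P ξ)
    (hcen : IsCentred P ξ) (hgauss : IsGaussianField P ξ)
    (hs : Summable (degreeScale P ξ G t)) : IsGaussianField P (homField ξ G t) :=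
  isGaussianProcess_of_mem_gaussianSpace hiso.1 (fun x => (hcen x).2) hgauss
    (memLp_homField hm hiso hs) (toLp_homField_mem_gaussianSpace hm hiso hs)

lemma memLp_prod_homField (hm : IsRandomField ξ) (hiso : IsTwoWeaklyIsotropic P ξ)
    (hcen : IsCentred P ξ) (hs : Summable (degreeScale P ξ G t)) :
    MemLp (fun p : Ω × S2 => homField ξ G t p.1 p.2) 2 (P.prod sphereMeasure) :=
  memLp_tsum (memLp_prod_degreePart hm hiso hcen)
    (tsum_eLpNorm_prod_degreePart_ne_top hm hiso hcen hs)

lemma seriesTendsto_homField (hm : IsRandomField ξ) (hiso : IsTwoWeaklyIsotropic P ξ)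
    (hcen : IsCentred P ξ) (hs : Summable (degreeScale P ξ G t)) :
    SeriesTendsto P ξ G t (homField ξ G t) :=
  -- The partial sum up to degree $L$ has $L+1$ terms, hence the shift by one.
  (tendsto_eLpNorm_sum_sub_tsum (memLp_prod_degreePart hm hiso hcen)
    (tsum_eLpNorm_prod_degreePart_ne_top hm hiso hcen hs)).comp (tendsto_add_atTop_nat 1)

end HomField

end SphericalField

end

/-! ### Assembly of the proposition. -/

theorem proposition3p2 {Ω : Type*} [MeasurableSpace Ω] (P : MeasureTheory.Measure Ω)
    [MeasureTheory.IsProbabilityMeasure P]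
    (c γ k α : ℝ) (hc : 0 < c) (hγ : 0 < γ) (hk : 0 < k) (hα : 1 / 2 < α) (hα1 : α ≤ 1)
    (ξ : Ω → SphericalField.S2 → ℝ)
    (hξ : SphericalField.IsRandomField ξ)
    (hξ_centred : SphericalField.IsCentred P ξ)
    (hξ_iso : SphericalField.IsTwoWeaklyIsotropic P ξ)
    (hξ_gauss : SphericalField.IsGaussianField P ξ)
    (D C κ₁ : ℝ) (hD : 0 < D) (hC : 0 < C) (hκ₁ : 4 < κ₁)
    (hC₀ : SphericalField.angularPowerSpectrum P ξ 0 ≤ D)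
    (hCℓ : ∀ ℓ : ℕ, 1 ≤ ℓ →
      SphericalField.angularPowerSpectrum P ξ ℓ ≤ C * (ℓ : ℝ) ^ (-κ₁))
    (G : ℕ → ℝ → ℂ)
    (hG : G = SphericalField.F c γ k α ∨ G = SphericalField.FLim c γ k α)
    (t : ℝ) (ht : 0 ≤ t) :
    -- the time factors are real, and the series converges in `L₂(Ω × 𝕊²)` to the field
    (∀ ℓ : ℕ, (G ℓ t).im = 0) ∧
    SphericalField.IsRandomField (SphericalField.homField ξ G t) ∧
    MeasureTheory.MemLp
      (fun p : Ω × SphericalField.S2 => SphericalField.homField ξ G t p.1 p.2) 2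
      (P.prod SphericalField.sphereMeasure) ∧
    SphericalField.SeriesTendsto P ξ G t (SphericalField.homField ξ G t) ∧
    -- the field is centred, 2-weakly isotropic and Gaussian
    SphericalField.IsCentred P (SphericalField.homField ξ G t) ∧
    SphericalField.IsTwoWeaklyIsotropic P (SphericalField.homField ξ G t) ∧
    SphericalField.IsGaussianField P (SphericalField.homField ξ G t) ∧
    -- its random coefficients
    (∀ ℓ : ℕ, ∀ m ∈ SphericalField.orders ℓ,
      (∀ᵐ ω ∂P, ((SphericalField.coeff (SphericalField.homField ξ G t) ℓ m ω : ℝ) : ℂ) =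
        G ℓ t * ((SphericalField.coeff ξ ℓ m ω : ℝ) : ℂ)) ∧
      MeasureTheory.MemLp (SphericalField.coeff (SphericalField.homField ξ G t) ℓ m) 2 P ∧
      ∫ ω, SphericalField.coeff (SphericalField.homField ξ G t) ℓ m ω ∂P = 0) ∧
    -- their covariances
    (∀ ℓ : ℕ, ∀ m ∈ SphericalField.orders ℓ, ∀ ℓ' : ℕ, ∀ m' ∈ SphericalField.orders ℓ',
      ∫ ω, SphericalField.coeff (SphericalField.homField ξ G t) ℓ m ω *
          SphericalField.coeff (SphericalField.homField ξ G t) ℓ' m' ω ∂P =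
        if ℓ = ℓ' ∧ m = m' then
          ‖G ℓ t‖ ^ 2 * SphericalField.angularPowerSpectrum P ξ ℓ
        else 0) := by
  obtain ⟨B, hB0, hB⟩ := SphericalField.exists_norm_timeFactor_le hc hγ hk (by linarith) hα1 ht hG
  have hs : Summable (SphericalField.degreeScale P ξ G t) :=
    SphericalField.summable_degreeScale hB0 hB hC (by linarith) hCℓ
  have him : ∀ ℓ, (G ℓ t).im = 0 := fun ℓ => by
    rcases hG with rfl | rfl
    · exact SphericalField.im_F c γ k α ℓ t
    · exact SphericalField.im_FLim c γ k α ℓ t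
  have hre : ∀ ℓ, (((G ℓ t).re : ℝ) : ℂ) = G ℓ t := fun ℓ =>
    Complex.ext (Complex.ofReal_re _) ((Complex.ofReal_im _).trans (him ℓ).symm)
  have hae := fun ℓ m (hm : m ∈ SphericalField.orders ℓ) =>
    SphericalField.ae_coeff_homField hξ hξ_iso hξ_centred hs hm
  refine ⟨him, SphericalField.isRandomField_homField hξ,
    SphericalField.memLp_prod_homField hξ hξ_iso hξ_centred hs,
    SphericalField.seriesTendsto_homField hξ hξ_iso hξ_centred hs,
    SphericalField.isCentred_homField hξ hξ_iso hξ_centred hs,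
    SphericalField.isTwoWeaklyIsotropic_homField hξ hξ_iso hξ_centred hs,
    SphericalField.isGaussianField_homField hξ hξ_iso hξ_centred hξ_gauss hs,
    fun ℓ m hm => ⟨?_, ?_, ?_⟩, fun ℓ m hm ℓ' m' hm' => ?_⟩
  · filter_upwards [hae ℓ m hm] with ω hω
    rw [hω, Complex.ofReal_mul, hre]
  · exact ((SphericalField.memLp_coeff hξ hξ_iso ℓ m).const_mul _).ae_eq
      ((hae ℓ m hm).mono fun ω hω => hω.symm)
  · rw [MeasureTheory.integral_congr_ae (hae ℓ m hm), MeasureTheory.integral_const_mul,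
      SphericalField.coeff_eq_pairing,
      SphericalField.integral_pairing_eq_zero (hξ_iso.memLp_prod hξ) hξ_centred, mul_zero]
  · have h : ∀ᵐ ω ∂P, SphericalField.coeff (SphericalField.homField ξ G t) ℓ m ω *
        SphericalField.coeff (SphericalField.homField ξ G t) ℓ' m' ω =
        ((G ℓ t).re * (G ℓ' t).re) *
          (SphericalField.coeff ξ ℓ m ω * SphericalField.coeff ξ ℓ' m' ω) := by
      filter_upwards [hae ℓ m hm, hae ℓ' m' hm'] with ω h1 h2
      rw [h1, h2]
      ring
    rw [MeasureTheory.integral_congr_ae h, MeasureTheory.integral_const_mul,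
      hξ_iso.integral_coeff_mul_coeff hξ hm]
    split_ifs with heq
    -- The series is built from the real parts of the time factors; the vanishing imaginary part
    -- identifies their squares with $|G_\ell(t)|^2$.
    · rw [← heq.1, Complex.sq_norm, Complex.normSq_apply, him]
      ring
    · rw [mul_zero]
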